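/- A polytope is the convex hull of a finite set. An extension of a polytope $P\subset\mathbb R^k$ is a polytope $Q\subset\mathbb R^d$ (any $d$) with $\pi(Q)=P$ for some linear map $\pi:\mathbb R^d\to\mathbb R^k$; its size is the number of facets of $Q$, and the extension complexity $\operatorname{xc}(P)$ is the smallest size of an extension of $P$. For $a,b,c\in\mathbb R^2$ let $\Delta(a,b,c)=\det(a-b,\,c-b)$. A sequence $v=(v_1,\dots,v_n)$ of distinct points of $\mathbb R^2$ ($n\ge 3$, $v_{n+1}:=v_1$) is *proper* if $\Delta(v_1,v_2,v_3)>0$ and each segment $\operatorname{conv}\{v_j,v_{j+1}\}$, $1\le j\le n$, is an edge of $\operatorname{conv}\{v_1,\dots,v_n\}$; put $S_i^j=\Delta(v_i,v_j,v_{j+1})$. A proper sequence is *admissible* if $S_t^pS_q^r>S_q^pS_t^r$ for all indices $p,q,r,t\in\{1,\dots,n\}$ with $p\le n-1$ that satisfy (i) $\min\{p,q-1\}>r>t$ or (ii) $q>p>\max\{r,t\}$. A *generic $n$-gon* is a convex $n$-gon (given by its $n$ vertices) whose $2n$ vertex coordinates are algebraically independent over $\mathbb Q$. **Theorem.** Let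 $n\ge 3$. 1. The set of admissible sequences of length $n$ is open in $(\mathbb R^2)^n$ and non-empty. 2. For every admissible $(v_1,\dots,v_n)$, $\operatorname{xc}(\operatorname{conv}\{v_1,\dots,v_n\})\le 17\sqrt n$. 3. Almost every (with respect to Lebesgue measure on $(\mathbb R^2)^n$) admissible sequence is the vertex sequence of a generic $n$-gon. 4. Consequently there is a generic $n$-gon, with admissible vertex sequence, of extension complexity at most $17\sqrt n$. Hence an $\Omega(\sqrt n)$ lower bound for the extension complexities of all generic $n$-gons cannot be improved in order: if $f:\mathbb N\to\mathbb R$ is such that, for all sufficiently large $n$, every generic $n$-gon has extension complexity at least $f(n)$, then $f(n)\le 17\sqrt n$ for all sufficiently large $n$. -/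

import Mathlib

open MeasureTheory Filter

noncomputable section

/-- The Euclidean plane. -/
abbrev Plane : Type := EuclideanSpace ℝ (Fin 2)

/-! ### Polytopes, facets, extension complexity -/

/-- A polytope: the convex hull of a finite set of points. -/
def IsPolytope {d : ℕ} (Q : Set (EuclideanSpace ℝ (Fin d))) : Prop :=
  ∃ s : Set (EuclideanSpace ℝ (Fin d)), s.Finite ∧ Q = convexHull ℝ s

/-- `F` is a facet of `Q`: a nonempty (exposed) face whose dimension is one less than that
of `Q`. -/
def IsFacet {d : ℕ} (Q F : Set (EuclideanSpace ℝ (Fin d))) : Prop :=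
  IsExposed ℝ Q F ∧ F.Nonempty ∧
    Module.finrank ℝ (vectorSpan ℝ F) + 1 = Module.finrank ℝ (vectorSpan ℝ Q)

/-- `Q` is an extension (linear extended formulation) of `P`: a polytope in some `ℝ^d` whose
image under some linear map `ℝ^d → ℝ^k` is `P`. -/
def IsExtension {d k : ℕ} (Q : Set (EuclideanSpace ℝ (Fin d)))
    (P : Set (EuclideanSpace ℝ (Fin k))) : Prop :=
  IsPolytope Q ∧ ∃ π : EuclideanSpace ℝ (Fin d) →ₗ[ℝ] EuclideanSpace ℝ (Fin k), π '' Q = P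

/-- The extension complexity of `P`: the least number of facets of an extension of `P`
(`⊤` if there is none). -/
def extensionComplexity {k : ℕ} (P : Set (EuclideanSpace ℝ (Fin k))) : ℕ∞ :=
  sInf {c : ℕ∞ | ∃ (d : ℕ) (Q : Set (EuclideanSpace ℝ (Fin d))),
    IsExtension Q P ∧ {F | IsFacet Q F}.encard = c}

/-! ### Proper and admissible sequences of points of the plane -/

/-- The oriented area of the parallelogram spanned by the vectors from `b` to `a` and from
`b` to `c`. -/
def orientedArea (a b c : Plane) : ℝ :=
  (a 0 - b 0) * (c 1 - b 1) - (a 1 - b 1) * (c 0 - b 0)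

/-- The sequence `v` (indexed by `0, …, n - 1`) lists the vertices of a convex `n`-gon in cyclic
order, in the direction that makes `orientedArea` of three consecutive ones positive: its members
are distinct, any two cyclically consecutive ones span an edge of the convex hull, and the first
three have positive oriented area. -/
def IsProperSequence {n : ℕ} (v : Fin n → Plane) : Prop :=
  Function.Injective v ∧
  (∃ h : 3 ≤ n,
    0 < orientedArea (v ⟨0, by lia⟩) (v ⟨1, by lia⟩) (v ⟨2, by lia⟩)) ∧
  ∀ j : Fin n,
    IsExposed ℝ (convexHull ℝ (Set.range v)) (segment ℝ (v j) (v (finRotate n j)))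

/-- The slack matrix: the entry in row `i` and column `j` is the oriented area of
`v i`, `v j`, `v (j + 1)`, the index `j + 1` being taken cyclically. -/
def slack {n : ℕ} (v : Fin n → Plane) (i j : Fin n) : ℝ :=
  orientedArea (v i) (v j) (v (finRotate n j))

/-- Admissible sequences. Write `S i j = slack v i j`. The columns `p` and `r` stand for the edges
joining `v j` to `v (j + 1)` with both ends inside the sequence: the last column, which belongs to
the closing edge from the last point back to the first, does not take part. (In the second case
`p + 1 < n` follows from `p < q`, and `r + 1 < n` from `r < p` in both cases.) -/
def IsAdmissible {n : ℕ} (v : Fin n → Plane) : Prop :=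
  IsProperSequence v ∧
  ∀ p q r t : Fin n, (p : ℕ) + 1 < n →
    ((r < p ∧ (r : ℕ) + 1 < (q : ℕ) ∧ t < r) ∨ (p < q ∧ r < p ∧ t < p)) →
      slack v q p * slack v t r < slack v t p * slack v q r

/-- `v` lists (in any order) the vertices of a generic convex `n`-gon: the points are in convex
position and their `2 n` coordinates are algebraically independent over `ℚ`. -/
def IsGenericPolygon {n : ℕ} (v : Fin n → Plane) : Prop :=
  ConvexIndependent ℝ v ∧
    AlgebraicIndependent ℚ (fun ij : Fin n × Fin 2 => v ij.1 ij.2)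

end

/-! By Yannakakis, an extension of a polygon with at most `r` facets arises from writing its slack
matrix as a sum of `r` nonnegative rank-one matrices, so the task is to factor the slack matrix of
an admissible sequence with `O(√n)` terms.

Put `k = ⌊√n⌋` and cut the first `k * k` points into `k` blocks of `k` consecutive ones. For two
columns `r < p` in the same position of different blocks, admissibility together with convexity says
that the ratio of the distances to `p` and to `r` is larger at every point before a separating index
than at every point after it (`tripleProduct_minor_of_separated`). Hence the columns of one residue
class can be rescaled so that each row is smallest at the column of its own block
(`exists_column_scaling`). Subtracting these minima costs one rank-one term per residue class.

What remains is nonnegative, and within one block of rows each column is a linear functional of the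
homogenized point. The block lies in the triangle spanned by its first point, its last point and the
intersection of the lines of its first and last edges. The functionals are nonnegative at all three
corners, so three terms per block suffice (`nonnegRankLE_blocks`). This gives `4 * k` terms; the few
rows and columns left out bring the total to at most `9 * k`.

Admissibility is a finite system of strict polynomial inequalities, satisfied by the points `(4 ^ i,
2 ^ i)` of a parabola, so admissible sequences form a nonempty open set, which has positive measure.
Algebraic dependence of the coordinates is a countable union of null sets, and the sharpness
statement follows. -/

/-! ### Nonnegative rank -/

/-- `M` is a sum of `r` nonnegative matrices of rank at most one. -/
def NonnegRankLE {ι κ : Type*} (M : ι → κ → ℝ) (r : ℕ) : Prop :=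
  ∃ (A : ι → Fin r → ℝ) (B : Fin r → κ → ℝ),
    (∀ i l, 0 ≤ A i l) ∧ (∀ l j, 0 ≤ B l j) ∧ ∀ i j, M i j = ∑ l, A i l * B l j

namespace NonnegRankLE

variable {ι κ : Type*}

theorem zero : NonnegRankLE (fun (_ : ι) (_ : κ) => (0 : ℝ)) 0 :=
  ⟨fun _ _ => 0, fun _ _ => 0, by simp, by simp, by simp⟩

theorem outer {f : ι → ℝ} {g : κ → ℝ} (hf : ∀ i, 0 ≤ f i) (hg : ∀ j, 0 ≤ g j) :
    NonnegRankLE (fun i j => f i * g j) 1 :=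
  ⟨fun i _ => f i, fun _ j => g j, fun i _ => hf i, fun _ j => hg j, by simp⟩

theorem add {M N : ι → κ → ℝ} {r s : ℕ} (hM : NonnegRankLE M r) (hN : NonnegRankLE N s) :
    NonnegRankLE (fun i j => M i j + N i j) (r + s) := by
  obtain ⟨A, B, hA, hB, hAB⟩ := hM
  obtain ⟨C, D, hC, hD, hCD⟩ := hN
  refine ⟨fun i => Fin.append (A i) (C i), Fin.append B D, fun i l => ?_, fun l j => ?_,
    fun i j => ?_⟩
  · refine Fin.addCases (fun l => ?_) (fun l => ?_) l
    · simpa using hA i l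
    · simpa using hC i l
  · refine Fin.addCases (fun l => ?_) (fun l => ?_) l
    · simpa using hB l j
    · simpa using hD l j
  · simp [Fin.sum_univ_add, hAB, hCD]

theorem sum {α : Type*} (s : Finset α) {M : α → ι → κ → ℝ} {r : ℕ}
    (h : ∀ x ∈ s, NonnegRankLE (M x) r) :
    NonnegRankLE (fun i j => ∑ x ∈ s, M x i j) (s.card * r) := by
  classical
  induction s using Finset.induction_on with
  | empty => simpa using zero
  | insert a s ha ih =>
    have h1 := (h a (Finset.mem_insert_self a s)).add
      (ih fun x hx => h x (Finset.mem_insert_of_mem hx))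
    simp only [Finset.sum_insert ha, Finset.card_insert_of_notMem ha]
    convert h1 using 1
    ring

theorem mono {M : ι → κ → ℝ} {r s : ℕ} (hM : NonnegRankLE M r) (h : r ≤ s) :
    NonnegRankLE M s := by
  obtain ⟨t, rfl⟩ := Nat.exists_eq_add_of_le h
  have h0 : NonnegRankLE (fun (_ : ι) (_ : κ) => (0 : ℝ)) t :=
    ⟨fun _ _ => 0, fun _ _ => 0, by simp, by simp, by simp⟩
  simpa using hM.add h0

theorem comap {ι' κ' : Type*} {M : ι → κ → ℝ} {r : ℕ} (hM : NonnegRankLE M r) (f : ι' → ι)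
    (g : κ' → κ) : NonnegRankLE (fun i j => M (f i) (g j)) r := by
  obtain ⟨A, B, hA, hB, hAB⟩ := hM
  exact ⟨fun i => A (f i), fun l j => B l (g j), fun i l => hA _ _, fun l j => hB _ _,
    fun i j => hAB _ _⟩

theorem of_rows [DecidableEq ι] (s : Finset ι) {M : ι → κ → ℝ} (hM : ∀ i j, 0 ≤ M i j) :
    NonnegRankLE (fun i j => if i ∈ s then M i j else 0) s.card := by
  have h := sum s (M := fun x i j => (if i = x then 1 else 0) * M x j) (r := 1) fun x _ =>
    outer (fun i => by split_ifs <;> norm_num) (hM x)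
  simpa using h

theorem of_columns [DecidableEq κ] (s : Finset κ) {M : ι → κ → ℝ} (hM : ∀ i j, 0 ≤ M i j) :
    NonnegRankLE (fun i j => if j ∈ s then M i j else 0) s.card := by
  have h := sum s (M := fun x i j => M i x * (if j = x then 1 else 0)) (r := 1) fun x _ =>
    outer (fun i => hM i x) (fun j => by split_ifs <;> norm_num)
  simpa using h

end NonnegRankLE

/-! ### Triple products -/

/-- The determinant of three vectors of `ℝ³`. -/
def tripleProduct (a b c : Fin 3 → ℝ) : ℝ :=
  a 0 * (b 1 * c 2 - b 2 * c 1) - a 1 * (b 0 * c 2 - b 2 * c 0) + a 2 * (b 0 * c 1 - b 1 * c 0)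

/-- The cross product of two vectors of `ℝ³`. -/
def cross (a b : Fin 3 → ℝ) : Fin 3 → ℝ :=
  ![a 1 * b 2 - a 2 * b 1, a 2 * b 0 - a 0 * b 2, a 0 * b 1 - a 1 * b 0]

theorem tripleProduct_rotate (a b c : Fin 3 → ℝ) : tripleProduct a b c = tripleProduct b c a := by
  unfold tripleProduct; ring

theorem tripleProduct_swap (a b c : Fin 3 → ℝ) : tripleProduct a b c = -tripleProduct b a c := by
  unfold tripleProduct; ring

theorem tripleProduct_self (a b : Fin 3 → ℝ) : tripleProduct a a b = 0 := by
  unfold tripleProduct; ring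

theorem tripleProduct_self' (a b : Fin 3 → ℝ) : tripleProduct a b a = 0 := by
  unfold tripleProduct; ring

/-- The three-term Grassmann–Plücker relation. -/
theorem tripleProduct_plucker (i u a b c : Fin 3 → ℝ) :
    tripleProduct i u b * tripleProduct i a c =
      tripleProduct i u a * tripleProduct i b c + tripleProduct i u c * tripleProduct i a b := by
  unfold tripleProduct; ring

/-- Shows that the normals `cross (w j) (w (j + 1))` of the edges inherit the positivity hypothesis
of `w`: projective duality of convex polygons. -/
theorem tripleProduct_cross_cross (a b u v w : Fin 3 → ℝ) :
    tripleProduct (cross a b) (cross u v) (cross v w) =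
      tripleProduct u v w * tripleProduct v a b := by
  simp [tripleProduct, cross]; ring

/-- Turns a two-by-two minor of the slack matrix into a triple product of normals when `a` and `b`
are consecutive points. -/
theorem tripleProduct_cross_eq (a b p q r s : Fin 3 → ℝ) :
    tripleProduct (cross a b) (cross p q) (cross r s) =
      tripleProduct a p q * tripleProduct b r s - tripleProduct b p q * tripleProduct a r s := by
  simp [tripleProduct, cross]; ring

/-- Writing `v` in terms of `a`, `d` and the intersection of the planes `a b` and `c d`. -/
theorem tripleProduct_expand (v a b c d p q : Fin 3 → ℝ) :
    tripleProduct v p q * (tripleProduct d a b * tripleProduct a c d) =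
      tripleProduct v c d * tripleProduct d a b * tripleProduct a p q +
      tripleProduct v a b * tripleProduct a c d * tripleProduct d p q +
      tripleProduct a v d * tripleProduct (cross p q) (cross a b) (cross c d) := by
  simp [tripleProduct, cross]; ring

/-- A sequence of vectors all of whose consecutive pairs see the other members on the positive
side has all its increasing triples positively oriented. -/
theorem tripleProduct_pos_of_consecutive {w : ℕ → Fin 3 → ℝ} {N : ℕ}
    (h : ∀ i j, i < N → j + 1 < N → i ≠ j → i ≠ j + 1 →
      0 < tripleProduct (w i) (w j) (w (j + 1)))
    {i j k : ℕ} (hij : i < j) (hjk : j < k) (hk : k < N) :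
    0 < tripleProduct (w i) (w j) (w k) := by
  have base : ∀ m, i + 1 < m → m < N → 0 < tripleProduct (w i) (w (i + 1)) (w m) := by
    intro m h1 h2
    rw [← tripleProduct_rotate]
    exact h m i h2 (by omega) (by omega) (by omega)
  rcases Nat.eq_or_lt_of_le (Nat.succ_le_of_lt hij) with rfl | hij'
  · exact base k hjk hk
  · have hij'' : i + 1 < j := hij'
    clear hij'
    induction k, hjk using Nat.le_induction with
    | base => exact h i j (by omega) hk (by omega) (by omega)
    | succ k hjk ih =>
      have hjk' : j < k := hjk
      have h1 := tripleProduct_plucker (w i) (w (i + 1)) (w j) (w k) (w (k + 1))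
      have h2 := base k (by omega) (by omega)
      have h3 := base (k + 1) (by omega) hk
      have h4 := base j hij'' (by omega)
      have h5 := h i k (by omega) hk (by omega) (by omega)
      have h6 := ih (by omega)
      -- In the Plücker relation both products on the right are positive, one of them by the
      -- induction hypothesis.
      have : 0 < tripleProduct (w i) (w (i + 1)) (w k) *
          tripleProduct (w i) (w j) (w (k + 1)) := by rw [h1]; positivity
      exact pos_of_mul_pos_right this h2.le

/-- The preceding result applied to the dual sequence of edge normals, which is one shorter. -/
theorem tripleProduct_cross_pos {w : ℕ → Fin 3 → ℝ} {N : ℕ}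
    (h : ∀ i j, i < N → j + 1 < N → i ≠ j → i ≠ j + 1 →
      0 < tripleProduct (w i) (w j) (w (j + 1)))
    {i j k : ℕ} (hij : i < j) (hjk : j < k) (hk : k + 1 < N) :
    0 < tripleProduct (cross (w i) (w (i + 1))) (cross (w j) (w (j + 1)))
      (cross (w k) (w (k + 1))) := by
  refine tripleProduct_pos_of_consecutive (w := fun j => cross (w j) (w (j + 1))) (N := N - 1)
    (fun i j hi hj hne hne' => ?_) hij hjk (by omega)
  rw [tripleProduct_cross_cross]
  refine mul_pos ?_ (h (j + 1) i (by omega) (by omega) (by omega) (by omega))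
  exact tripleProduct_pos_of_consecutive h (by omega) (by omega) (by omega)

/-! ### Factorization of the interior part of the slack matrix -/

section Blocks

variable {w : ℕ → Fin 3 → ℝ} {N : ℕ}

theorem tripleProduct_nonneg_of_consecutive
    (h : ∀ i j, i < N → j + 1 < N → i ≠ j → i ≠ j + 1 →
      0 < tripleProduct (w i) (w j) (w (j + 1))) {i j : ℕ} (hi : i < N) (hj : j + 1 < N) :
    0 ≤ tripleProduct (w i) (w j) (w (j + 1)) := by
  rcases eq_or_ne i j with rfl | h1
  · rw [tripleProduct_self]
  rcases eq_or_ne i (j + 1) with rfl | h2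
  · rw [tripleProduct_self']
  exact (h i j hi hj h1 h2).le

/-- Between two edges `r` and `p`, the ratio of the distances to `p` and to `r` decreases. -/
theorem tripleProduct_minor_of_between
    (h : ∀ i j, i < N → j + 1 < N → i ≠ j → i ≠ j + 1 →
      0 < tripleProduct (w i) (w j) (w (j + 1)))
    {r t q p : ℕ} (hrt : r + 1 < t) (htq : t < q) (hqp : q ≤ p) (hp : p + 1 < N) :
    tripleProduct (w q) (w p) (w (p + 1)) * tripleProduct (w t) (w r) (w (r + 1)) <
      tripleProduct (w t) (w p) (w (p + 1)) * tripleProduct (w q) (w r) (w (r + 1)) := by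
  have step : ∀ m, r + 1 < m → m < p →
      tripleProduct (w (m + 1)) (w p) (w (p + 1)) * tripleProduct (w m) (w r) (w (r + 1)) <
        tripleProduct (w m) (w p) (w (p + 1)) * tripleProduct (w (m + 1)) (w r) (w (r + 1)) := by
    intro m h1 h2
    have h3 := tripleProduct_cross_pos h (i := r) (j := m) (k := p) (by omega) h2 hp
    rw [tripleProduct_rotate, tripleProduct_cross_eq] at h3
    linarith
  induction q, htq using Nat.le_induction with
  | base => exact step t hrt (by omega)
  | succ q htq ih =>
    have h1 := ih (by omega)
    have h2 := step q (by omega) (by omega)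
    have h3 := h q r (by omega) (by omega) (by omega) (by omega)
    have h4 := h t r (by omega) (by omega) (by omega) (by omega)
    -- The two inequalities are chained through the slack of `q` at `r`, which is positive; the
    -- slacks at `p` may vanish and cannot be cancelled.
    refine lt_of_mul_lt_mul_right ?_ h3.le
    calc _ = (tripleProduct (w (q + 1)) (w p) (w (p + 1)) *
              tripleProduct (w q) (w r) (w (r + 1))) *
              tripleProduct (w t) (w r) (w (r + 1)) := by ring
      _ < (tripleProduct (w q) (w p) (w (p + 1)) *
              tripleProduct (w (q + 1)) (w r) (w (r + 1))) *
              tripleProduct (w t) (w r) (w (r + 1)) := mul_lt_mul_of_pos_right h2 h4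
      _ = (tripleProduct (w q) (w p) (w (p + 1)) *
              tripleProduct (w t) (w r) (w (r + 1))) *
              tripleProduct (w (q + 1)) (w r) (w (r + 1)) := by ring
      _ ≤ (tripleProduct (w t) (w p) (w (p + 1)) *
              tripleProduct (w q) (w r) (w (r + 1))) *
              tripleProduct (w (q + 1)) (w r) (w (r + 1)) :=
          mul_le_mul_of_nonneg_right h1.le
            (tripleProduct_nonneg_of_consecutive h (by omega) (by omega))
      _ = _ := by ring

variable
    (h : ∀ i j, i < N → j + 1 < N → i ≠ j → i ≠ j + 1 →
      0 < tripleProduct (w i) (w j) (w (j + 1)))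
    (hadm : ∀ p q r t, q < N → p + 1 < N →
      ((r < p ∧ r + 1 < q ∧ t < r) ∨ (p < q ∧ r < p ∧ t < p)) →
      tripleProduct (w q) (w p) (w (p + 1)) * tripleProduct (w t) (w r) (w (r + 1)) <
        tripleProduct (w t) (w p) (w (p + 1)) * tripleProduct (w q) (w r) (w (r + 1)))

include h hadm

/-- Admissibility covers `t < r` and `p < q`; if `t` is an end of the edge `r`, the left side
vanishes; the remaining position, both points between the two edges, is automatic by convexity. -/
theorem tripleProduct_minor_of_separated {r u p t q : ℕ} (hru : r < u) (hup : u < p)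
    (hp : p + 1 < N) (ht : t ≤ u) (hq : u < q) (hqN : q < N) :
    tripleProduct (w q) (w p) (w (p + 1)) * tripleProduct (w t) (w r) (w (r + 1)) <
      tripleProduct (w t) (w p) (w (p + 1)) * tripleProduct (w q) (w r) (w (r + 1)) := by
  have hpos := mul_pos (h t p (by omega) hp (by omega) (by omega))
    (h q r hqN (by omega) (by omega) (by omega))
  rcases lt_trichotomy t r with htr | rfl | hrt
  · exact hadm p q r t hqN hp (Or.inl ⟨by omega, by omega, htr⟩)
  · rwa [tripleProduct_self, mul_zero]
  rcases Nat.eq_or_lt_of_le (Nat.succ_le_of_lt hrt) with rfl | hrt'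
  · rwa [Nat.succ_eq_add_one, tripleProduct_self', mul_zero]
  rcases lt_or_ge p q with hpq | hqp
  · exact hadm p q r t hqN hp (Or.inr ⟨hpq, by omega, by omega⟩)
  · exact tripleProduct_minor_of_between h hrt' (by omega) hqp hp

/-- The threshold `τ` is the largest ratio of the two slacks beyond `u`; every ratio up to `u`
exceeds it. The extra point in `hne`, off the edge `p`, makes `τ` positive. -/
theorem exists_separating_ratio {r u p : ℕ} (hru : r < u) (hup : u < p) (hp : p + 1 < N)
    (hne : ∃ q, u < q ∧ q < N ∧ q ≠ p ∧ q ≠ p + 1) :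
    ∃ τ : ℝ, 0 < τ ∧
      (∀ t, t ≤ u → τ * tripleProduct (w t) (w r) (w (r + 1)) ≤
        tripleProduct (w t) (w p) (w (p + 1))) ∧
      ∀ q, u < q → q < N → tripleProduct (w q) (w p) (w (p + 1)) ≤
        τ * tripleProduct (w q) (w r) (w (r + 1)) := by
  have hr : ∀ q, u < q → q < N → 0 < tripleProduct (w q) (w r) (w (r + 1)) :=
    fun q h1 h2 => h q r h2 (by omega) (by omega) (by omega)
  obtain ⟨q₀, h₀, h₀', h₀'', h₀'''⟩ := hne
  obtain ⟨m, hm, hmax⟩ := Finset.exists_max_image (Finset.Ioo u N)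
    (fun q => tripleProduct (w q) (w p) (w (p + 1)) / tripleProduct (w q) (w r) (w (r + 1)))
    ⟨q₀, by simp [h₀, h₀']⟩
  simp only [Finset.mem_Ioo] at hm hmax
  refine ⟨tripleProduct (w m) (w p) (w (p + 1)) / tripleProduct (w m) (w r) (w (r + 1)),
    ?_, fun t ht => ?_, fun q h1 h2 => ?_⟩
  · exact (div_pos (h q₀ p h₀' hp h₀'' h₀''') (hr q₀ h₀ h₀')).trans_le (hmax q₀ ⟨h₀, h₀'⟩)
  · have := tripleProduct_minor_of_separated h hadm hru hup hp ht hm.1 hm.2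
    rw [div_mul_eq_mul_div, div_le_iff₀ (hr m hm.1 hm.2)]
    exact this.le
  · have := hmax q ⟨h1, h2⟩
    rwa [div_le_iff₀ (hr q h1 h2)] at this

end Blocks

/-- Scaling factors for the columns that make every row smallest, within each residue class of
columns, at the column of its own block. -/
theorem exists_column_scaling {w : ℕ → Fin 3 → ℝ} {k : ℕ} (hk : 3 ≤ k)
    (h : ∀ i j, i < k * k → j + 1 < k * k → i ≠ j → i ≠ j + 1 →
      0 < tripleProduct (w i) (w j) (w (j + 1)))
    (hadm : ∀ p q r t, q < k * k → p + 1 < k * k →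
      ((r < p ∧ r + 1 < q ∧ t < r) ∨ (p < q ∧ r < p ∧ t < p)) →
      tripleProduct (w q) (w p) (w (p + 1)) * tripleProduct (w t) (w r) (w (r + 1)) <
        tripleProduct (w t) (w p) (w (p + 1)) * tripleProduct (w q) (w r) (w (r + 1))) :
    ∃ s : ℕ → ℕ → ℝ, (∀ a b, 0 < s a b) ∧ ∀ a a' b i, a < k → a' < k → b + 1 < k →
      a * k ≤ i → i < a * k + k →
      s a' b / s a b * tripleProduct (w i) (w (a * k + b)) (w (a * k + b + 1)) ≤
        tripleProduct (w i) (w (a' * k + b)) (w (a' * k + b + 1)) := by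
  have hmul : ∀ a, a < k → a * k + k ≤ k * k := fun a ha => by nlinarith
  have key : ∀ c b, ∃ τ : ℝ, 0 < τ ∧ (c + 1 < k → b + 1 < k →
      (∀ t, t < (c + 1) * k → τ * tripleProduct (w t) (w (c * k + b)) (w (c * k + b + 1)) ≤
        tripleProduct (w t) (w ((c + 1) * k + b)) (w ((c + 1) * k + b + 1))) ∧
      ∀ q, (c + 1) * k ≤ q → q < k * k →
        tripleProduct (w q) (w ((c + 1) * k + b)) (w ((c + 1) * k + b + 1)) ≤
        τ * tripleProduct (w q) (w (c * k + b)) (w (c * k + b + 1))) := by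
    intro c b
    by_cases hcb : c + 1 < k ∧ b + 1 < k
    · obtain ⟨hc, hb⟩ := hcb
      have hck := hmul (c + 1) hc
      have e : (c + 1) * k = c * k + k := by ring
      obtain ⟨τ, h1, h2, h3⟩ := exists_separating_ratio h hadm (r := c * k + b)
        -- The separating index is the last point of block `c`. A point of the next block off the
        -- edge `p` exists because `3 ≤ k`.
        (u := c * k + (k - 1)) (p := (c + 1) * k + b) (by omega) (by omega) (by omega) (by
          rcases Nat.eq_zero_or_pos b with rfl | hb'
          · exact ⟨(c + 1) * k + 2, by omega, by omega, by omega, by omega⟩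
          · exact ⟨(c + 1) * k, by omega, by omega, by omega, by omega⟩)
      exact ⟨τ, h1, fun _ _ => ⟨fun t ht => h2 t (by omega), fun q hq => h3 q (by omega)⟩⟩
    · exact ⟨1, one_pos, fun h1 h2 => absurd ⟨h1, h2⟩ hcb⟩
  choose τ hτ hτ' using key
  -- Multiplying the consecutive thresholds makes the scaled entries of a row decrease up to its own
  -- block and increase after it.
  set s : ℕ → ℕ → ℝ := fun a b => ∏ c ∈ Finset.range a, τ c b with hs
  have hspos : ∀ a b, 0 < s a b := fun a b => Finset.prod_pos fun c _ => hτ c b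
  have hsucc : ∀ a b, s (a + 1) b = s a b * τ a b := fun a b => Finset.prod_range_succ _ _
  refine ⟨s, hspos, fun a a' b i ha ha' hb hi hi' => ?_⟩
  rw [div_mul_eq_mul_div, div_le_iff₀ (hspos a b)]
  rcases le_total a a' with haa | haa
  · induction a', haa using Nat.le_induction with
    | base => rw [mul_comm]
    | succ c hac ih =>
      have h1 := (hτ' c b ha' hb).1 i (by nlinarith)
      have h2 := ih (by omega)
      rw [hsucc]
      have h3 := mul_le_mul_of_nonneg_right h2 (hτ c b).le
      have h4 := mul_le_mul_of_nonneg_right h1 (hspos a b).le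
      linarith
  · induction a, haa using Nat.le_induction generalizing i with
    | base => rw [mul_comm]
    | succ c hac _ =>
      -- The row must stay fixed, while the outer induction hypothesis concerns rows of an earlier
      -- block; hence an induction on the column block.
      have : ∀ d, a' + d ≤ c + 1 →
          s a' b * tripleProduct (w i) (w ((a' + d) * k + b)) (w ((a' + d) * k + b + 1)) ≤
          tripleProduct (w i) (w (a' * k + b)) (w (a' * k + b + 1)) * s (a' + d) b := by
        intro d
        induction d with
        | zero => intro _; rw [mul_comm, add_zero]
        | succ d ihd =>
          intro hd
          have h2 := ihd (by omega)
          have h5 : (a' + d + 1) * k ≤ (c + 1) * k := Nat.mul_le_mul_right k hd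
          have h1 := (hτ' (a' + d) b (by omega) hb).2 i (by omega)
            (by have := hmul (c + 1) ha; omega)
          rw [← add_assoc, hsucc]
          have h3 := mul_le_mul_of_nonneg_right h2 (hτ (a' + d) b).le
          have h4 := mul_le_mul_of_nonneg_left h1 (hspos a' b).le
          linarith
      have := this (c + 1 - a') (by omega)
      rwa [show a' + (c + 1 - a') = c + 1 by omega] at this

/-- The part of the slack matrix formed by `k` blocks of `k` consecutive points, without the
columns that join consecutive blocks, has nonnegative rank `O(k)`. -/
theorem nonnegRankLE_blocks {w : ℕ → Fin 3 → ℝ} {k : ℕ} (hk : 3 ≤ k)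
    (h : ∀ i j, i < k * k → j + 1 < k * k → i ≠ j → i ≠ j + 1 →
      0 < tripleProduct (w i) (w j) (w (j + 1)))
    (hadm : ∀ p q r t, q < k * k → p + 1 < k * k →
      ((r < p ∧ r + 1 < q ∧ t < r) ∨ (p < q ∧ r < p ∧ t < p)) →
      tripleProduct (w q) (w p) (w (p + 1)) * tripleProduct (w t) (w r) (w (r + 1)) <
        tripleProduct (w t) (w p) (w (p + 1)) * tripleProduct (w q) (w r) (w (r + 1))) :
    NonnegRankLE (fun i j : ℕ => if i < k * k ∧ j < k * k ∧ j % k + 1 < k then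
      tripleProduct (w i) (w j) (w (j + 1)) else 0) (k + k * 3) := by
  obtain ⟨s, hs, hscale⟩ := exists_column_scaling hk h hadm
  have hnn : ∀ i j, i < k * k → j + 1 < k * k → 0 ≤ tripleProduct (w i) (w j) (w (j + 1)) :=
    fun i j => tripleProduct_nonneg_of_consecutive h
  have hmul : ∀ a, a < k → a * k + k ≤ k * k := fun a ha => by nlinarith
  have hdm : ∀ i, i / k * k + i % k = i := fun i => Nat.div_add_mod' i k
  have hdl : ∀ i, i < k * k → i / k < k := fun i hi => Nat.div_lt_of_lt_mul hi
  have hml : ∀ i, i % k < k := fun i => Nat.mod_lt i (by omega)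
  -- the terms indexed by residue classes
  have hQ : NonnegRankLE (fun i j : ℕ => ∑ b ∈ Finset.range k,
      (if i < k * k ∧ b + 1 < k then tripleProduct (w i) (w (i / k * k + b)) (w (i / k * k + b + 1)) /
        s (i / k) b else 0) *
      (if j < k * k ∧ j % k + 1 < k ∧ j % k = b then s (j / k) b else 0))
      ((Finset.range k).card * 1) := by
    refine NonnegRankLE.sum _ fun b _ => NonnegRankLE.outer (fun i => ?_) (fun j => ?_)
    · split_ifs with hi
      · refine div_nonneg (hnn _ _ hi.1 ?_) (hs _ _).le
        have := hmul _ (hdl i hi.1)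
        omega
      · exact le_rfl
    · split_ifs
      exacts [(hs _ _).le, le_rfl]
  -- the terms indexed by blocks
  have hD : ∀ a ∈ Finset.range k, NonnegRankLE (fun i j : ℕ =>
      if i / k = a ∧ j < k * k ∧ j % k + 1 < k then
        tripleProduct (w i) (w j) (w (j + 1)) -
          s (j / k) (j % k) / s a (j % k) *
            tripleProduct (w i) (w (a * k + j % k)) (w (a * k + j % k + 1)) else 0) 3 := by
    intro a ha
    rw [Finset.mem_range] at ha
    have hak := hmul a ha
    -- `F` and `E` index the first and last edges of the block, whose last point is `E + 1`.
    set F : ℕ := a * k with hF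
    set E : ℕ := a * k + (k - 2) with hE
    have hE1 : E + 1 = a * k + k - 1 := by omega
    have hrow : ∀ i, i / k = a → F ≤ i ∧ i < F + k := by
      rintro i rfl
      have := hdm i
      have := hml i
      omega
    have hp1 : 0 < tripleProduct (w (E + 1)) (w F) (w (F + 1)) :=
      h _ _ (by omega) (by omega) (by omega) (by omega)
    have hp2 : 0 < tripleProduct (w F) (w E) (w (E + 1)) :=
      h _ _ (by omega) (by omega) (by omega) (by omega)
    have hfac : ∀ i, F ≤ i → i < F + k → ∀ j, j < k * k → j % k + 1 < k →
        0 ≤ tripleProduct (w i) (w j) (w (j + 1)) -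
          s (j / k) (j % k) / s a (j % k) *
            tripleProduct (w i) (w (F + j % k)) (w (F + j % k + 1)) := by
      intro i h1 h2 j h3 h4
      have := hscale a (j / k) (j % k) i ha (hdl j h3) h4 h1 h2
      rw [hdm] at this
      linarith
    -- `X j` is the slack at column `j` of the intersection of the lines `F` and `E`. This corner
    -- lies beyond the edges inside the block and on the inner side of all others.
    set X : ℕ → ℝ := fun j => tripleProduct (cross (w j) (w (j + 1)))
      (cross (w F) (w (F + 1))) (cross (w E) (w (E + 1))) with hX
    have hXin : ∀ j, F ≤ j → j ≤ E → X j ≤ 0 := by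
      intro j h1 h2
      rcases h1.eq_or_lt with rfl | h1
      · exact (tripleProduct_self _ _).le
      rcases h2.eq_or_lt with rfl | h2
      · exact (tripleProduct_self' _ _).le
      have := tripleProduct_cross_pos h h1 h2 (by omega)
      rw [hX]
      simp only
      rw [tripleProduct_swap]
      linarith
    have hXout : ∀ j, j + 1 < k * k → j < F ∨ E < j → 0 ≤ X j := by
      rintro j h1 (h2 | h2)
      · exact (tripleProduct_cross_pos h h2 (by omega) (by omega)).le
      · rw [hX]
        simp only
        rw [tripleProduct_rotate]
        exact (tripleProduct_cross_pos h (by omega) h2 h1).le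
    have g1 := NonnegRankLE.outer
      (f := fun i => if i / k = a then tripleProduct (w i) (w E) (w (E + 1)) /
        tripleProduct (w F) (w E) (w (E + 1)) else 0)
      (g := fun j => if j < k * k ∧ j % k + 1 < k then tripleProduct (w F) (w j) (w (j + 1)) -
          s (j / k) (j % k) / s a (j % k) *
            tripleProduct (w F) (w (F + j % k)) (w (F + j % k + 1)) else 0)
      (fun i => by
        split_ifs with hi
        · refine div_nonneg (hnn _ _ ?_ (by omega)) hp2.le
          have := hrow i hi
          omega
        · exact le_rfl)
      (fun j => by
        split_ifs with hj
        · exact hfac F le_rfl (by omega) j hj.1 hj.2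
        · exact le_rfl)
    have g2 := NonnegRankLE.outer
      (f := fun i => if i / k = a then tripleProduct (w i) (w F) (w (F + 1)) /
        tripleProduct (w (E + 1)) (w F) (w (F + 1)) else 0)
      (g := fun j => if j < k * k ∧ j % k + 1 < k then
        tripleProduct (w (E + 1)) (w j) (w (j + 1)) -
          s (j / k) (j % k) / s a (j % k) *
            tripleProduct (w (E + 1)) (w (F + j % k)) (w (F + j % k + 1)) else 0)
      (fun i => by
        split_ifs with hi
        · refine div_nonneg (hnn _ _ ?_ (by omega)) hp1.le
          have := hrow i hi
          omega
        · exact le_rfl)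
      (fun j => by
        split_ifs with hj
        · exact hfac (E + 1) (by omega) (by omega) j hj.1 hj.2
        · exact le_rfl)
    have g3 := NonnegRankLE.outer
      (f := fun i => if i / k = a then tripleProduct (w F) (w i) (w (E + 1)) /
        (tripleProduct (w (E + 1)) (w F) (w (F + 1)) *
          tripleProduct (w F) (w E) (w (E + 1))) else 0)
      (g := fun j => if j < k * k ∧ j % k + 1 < k then
        X j - s (j / k) (j % k) / s a (j % k) * X (F + j % k) else 0)
      (fun i => by
        split_ifs with hi
        · refine div_nonneg ?_ (mul_pos hp1 hp2).le
          have h1 := hrow i hi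
          rcases Nat.eq_or_lt_of_le (show F ≤ i by omega) with rfl | h3
          · rw [tripleProduct_self]
          rcases Nat.eq_or_lt_of_le (show i ≤ E + 1 by omega) with rfl | h4
          · rw [tripleProduct_rotate, tripleProduct_self]
          exact (tripleProduct_pos_of_consecutive h h3 h4 (by omega)).le
        · exact le_rfl)
      (fun j => by
        split_ifs with hj
        · have h1 := hdm j
          have h2 := hXin (F + j % k) (by omega) (by omega)
          have h3 : 0 < s (j / k) (j % k) / s a (j % k) := div_pos (hs _ _) (hs _ _)
          -- In the block's own columns the remainder is identically zero. In the others `X j` is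
          -- nonnegative and the subtracted value is nonpositive.
          rcases eq_or_ne (j / k) a with h4 | h4
          · rw [h4] at h1 ⊢
            rw [h1, div_self (hs _ _).ne', one_mul, sub_self]
          · have h5 : 0 ≤ X j := by
              have h6 := hmul _ (hdl j hj.1)
              refine hXout j (by omega) ?_
              rcases lt_or_gt_of_ne h4 with h4 | h4
              · left
                have : (j / k + 1) * k ≤ a * k := Nat.mul_le_mul_right k h4
                rw [add_mul] at this
                omega
              · right
                have : (a + 1) * k ≤ j / k * k := Nat.mul_le_mul_right k h4
                rw [add_mul] at this
                omega
            nlinarith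
        · exact le_rfl)
    convert (g1.add g2).add g3 using 3 with i j
    by_cases hi : i / k = a
    · by_cases hj : j < k * k ∧ j % k + 1 < k
      -- Each point of the block is a nonnegative combination of the triangle's corners, so a linear
      -- functional of it is the same combination of its corner values.
      · have e : ∀ c d, tripleProduct (w i) (w c) (w d) =
            tripleProduct (w i) (w E) (w (E + 1)) / tripleProduct (w F) (w E) (w (E + 1)) *
              tripleProduct (w F) (w c) (w d) +
            tripleProduct (w i) (w F) (w (F + 1)) / tripleProduct (w (E + 1)) (w F) (w (F + 1)) *
              tripleProduct (w (E + 1)) (w c) (w d) +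
            tripleProduct (w F) (w i) (w (E + 1)) /
              (tripleProduct (w (E + 1)) (w F) (w (F + 1)) *
                tripleProduct (w F) (w E) (w (E + 1))) *
              tripleProduct (cross (w c) (w d)) (cross (w F) (w (F + 1)))
                (cross (w E) (w (E + 1))) := by
          intro c d
          have := tripleProduct_expand (w i) (w F) (w (F + 1)) (w E) (w (E + 1)) (w c) (w d)
          field_simp
          linarith
        rw [if_pos ⟨hi, hj⟩, if_pos hi, if_pos hi, if_pos hi, if_pos hj, if_pos hj, if_pos hj,
          e j (j + 1), e (F + j % k) (F + j % k + 1)]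
        ring
      · simp [hj]
    · simp [hi]
  have hsum := hQ.add (NonnegRankLE.sum (Finset.range k) hD)
  rw [Finset.card_range, mul_one] at hsum
  convert hsum using 3 with i j
  by_cases hj : j < k * k ∧ j % k + 1 < k
  · by_cases hi : i < k * k
    · rw [if_pos ⟨hi, hj⟩, Finset.sum_eq_single (j % k), Finset.sum_eq_single (i / k)]
      · rw [if_pos ⟨hi, hj.2⟩, if_pos ⟨hj.1, hj.2, rfl⟩, if_pos ⟨rfl, hj⟩]
        ring
      · intro a _ ha
        rw [if_neg fun h => ha h.1.symm]
      · intro h'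
        exact absurd (Finset.mem_range.2 (hdl i hi)) h'
      · intro b _ hb
        rw [if_neg (c := _ ∧ _ ∧ _) fun h => hb h.2.2.symm, mul_zero]
      · intro h'
        exact absurd (Finset.mem_range.2 (hml j)) h'
    · rw [if_neg fun h => hi h.1, Finset.sum_eq_zero, Finset.sum_eq_zero, add_zero]
      · intro a ha
        rw [if_neg]
        rintro ⟨rfl, _⟩
        exact hi ((Nat.div_lt_iff_lt_mul (by omega)).1 (Finset.mem_range.1 ha))
      · intro b _
        rw [if_neg fun h => hi h.1, zero_mul]
  · rw [if_neg fun h => hj h.2, Finset.sum_eq_zero, Finset.sum_eq_zero, add_zero]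
    · intro a _
      rw [if_neg fun h => hj h.2]
    · intro b _
      rw [if_neg (c := _ ∧ _ ∧ _) fun h => hj ⟨h.1, h.2.1⟩, mul_zero]

/-! ### Proper sequences are those with positive slacks -/

theorem val_finRotate {n : ℕ} (j : Fin n) :
    (finRotate n j : ℕ) = if (j : ℕ) + 1 < n then (j : ℕ) + 1 else 0 := by
  cases n with
  | zero => exact j.elim0
  | succ m =>
    by_cases hj : j = Fin.last m
    · subst hj; simp
    · rw [coe_finRotate_of_ne_last hj, if_pos]
      have := Fin.val_lt_last hj
      omega

theorem finRotate_ne_self {n : ℕ} (hn : 2 ≤ n) (j : Fin n) : finRotate n j ≠ j := by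
  intro h
  have h1 := congrArg Fin.val h
  rw [val_finRotate] at h1
  split_ifs at h1 <;> omega

theorem finRotate_finRotate_ne_self {n : ℕ} (hn : 3 ≤ n) (j : Fin n) :
    finRotate n (finRotate n j) ≠ j := by
  intro h
  have h1 := congrArg Fin.val h
  rw [val_finRotate, val_finRotate] at h1
  split_ifs at h1 <;> omega

theorem orientedArea_rotate (a b c : Plane) : orientedArea a b c = orientedArea b c a := by
  unfold orientedArea; ring

theorem orientedArea_self_left (a b : Plane) : orientedArea a a b = 0 := by
  unfold orientedArea; ring

theorem orientedArea_self_right (a b : Plane) : orientedArea a b a = 0 := by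
  unfold orientedArea; ring

/-- The oriented area of `x` and the edge from `b` to `c` is affine in `x`. -/
theorem orientedArea_sum {ι : Type*} (s : Finset ι) (w : ι → ℝ) (z : ι → Plane)
    (hw : ∑ i ∈ s, w i = 1) (b c : Plane) :
    orientedArea (∑ i ∈ s, w i • z i) b c = ∑ i ∈ s, w i * orientedArea (z i) b c := by
  have e : ∀ x, orientedArea x b c =
      x 0 * (c 1 - b 1) - x 1 * (c 0 - b 0) + (b 1 * (c 0 - b 0) - b 0 * (c 1 - b 1)) := by
    intro x; unfold orientedArea; ring
  simp only [e, mul_add, mul_sub, Finset.sum_add_distrib, Finset.sum_sub_distrib, ← mul_assoc,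
    ← Finset.sum_mul, hw]
  simp

/-- The linear functional whose difference from its value at `b` is minus the oriented area. -/
noncomputable def edgeFunctional (b c : Plane) : Plane →L[ℝ] ℝ :=
  (c 0 - b 0) • EuclideanSpace.proj 1 - (c 1 - b 1) • EuclideanSpace.proj 0

theorem edgeFunctional_apply (b c x : Plane) :
    edgeFunctional b c x = (c 0 - b 0) * x 1 - (c 1 - b 1) * x 0 := by
  simp [edgeFunctional]

theorem edgeFunctional_eq (b c x : Plane) :
    edgeFunctional b c x = edgeFunctional b c b - orientedArea x b c := by
  simp only [edgeFunctional_apply, orientedArea]; ring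

theorem slack_nonneg {n : ℕ} {v : Fin n → Plane}
    (h : ∀ i j, i ≠ j → i ≠ finRotate n j → 0 < slack v i j) (i j : Fin n) : 0 ≤ slack v i j := by
  rcases eq_or_ne i j with rfl | h1
  · exact (orientedArea_self_left _ _).ge
  rcases eq_or_ne i (finRotate n j) with rfl | h2
  · exact (orientedArea_self_right _ _).ge
  exact (h i j h1 h2).le

theorem injective_of_slack_pos {n : ℕ} (hn : 3 ≤ n) {v : Fin n → Plane}
    (h : ∀ i j, i ≠ j → i ≠ finRotate n j → 0 < slack v i j) : Function.Injective v := by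
  have key : ∀ i j, v i = v j → i ≠ j → i = finRotate n j := by
    intro i j hv hij
    by_contra hr
    have := h i j hij hr
    rw [slack, hv, orientedArea_self_left] at this
    exact this.false
  intro i j hv
  by_contra hij
  have h1 := key i j hv hij
  have h2 := key j i hv.symm (Ne.symm hij)
  rw [h1] at h2
  exact finRotate_finRotate_ne_self hn j h2.symm

/-- A convex combination of the vertices maximizes `edgeFunctional` exactly when its weighted slacks
vanish, which puts all weight on the two ends. -/
theorem isExposed_edge_of_slack_pos {n : ℕ} {v : Fin n → Plane}
    (h : ∀ i j, i ≠ j → i ≠ finRotate n j → 0 < slack v i j) (j : Fin n) :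
    IsExposed ℝ (convexHull ℝ (Set.range v)) (segment ℝ (v j) (v (finRotate n j))) := by
  intro _
  have hmem : ∀ i, v i ∈ convexHull ℝ (Set.range v) :=
    fun i => subset_convexHull ℝ _ (Set.mem_range_self i)
  have hnn : ∀ x ∈ convexHull ℝ (Set.range v), ∃ w : Fin n → ℝ, (∀ i, 0 ≤ w i) ∧
      ∑ i, w i = 1 ∧ ∑ i, w i • v i = x := by
    intro x hx
    rw [convexHull_range_eq_exists_affineCombination] at hx
    obtain ⟨s, w, hw, hw1, rfl⟩ := hx
    classical
    refine ⟨fun i => if i ∈ s then w i else 0, fun i => ?_, ?_, ?_⟩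
    · dsimp only
      split_ifs with hi
      exacts [hw i hi, le_rfl]
    · simpa [Finset.sum_ite_mem] using hw1
    · rw [Finset.affineCombination_eq_linear_combination _ _ _ hw1]
      simp [ite_smul, Finset.sum_ite_mem]
  refine ⟨edgeFunctional (v j) (v (finRotate n j)), Set.ext fun x => ⟨fun hx => ?_, fun hx => ?_⟩⟩
  · refine ⟨(convex_convexHull ℝ _).segment_subset (hmem _) (hmem _) hx, fun y hy => ?_⟩
    obtain ⟨w, hw, hw1, rfl⟩ := hnn y hy
    rw [edgeFunctional_eq _ _ x, edgeFunctional_eq _ _ (∑ i, w i • v i), orientedArea_sum _ _ _ hw1]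
    have h1 : orientedArea x (v j) (v (finRotate n j)) = 0 := by
      obtain ⟨a, b, -, -, hab, rfl⟩ := hx
      have : a = 1 - b := by linarith
      subst this
      simp [orientedArea]; ring
    have h2 : 0 ≤ ∑ i, w i * orientedArea (v i) (v j) (v (finRotate n j)) :=
      Finset.sum_nonneg fun i _ => mul_nonneg (hw i) (slack_nonneg h i j)
    linarith
  · obtain ⟨w, hw, hw1, rfl⟩ := hnn x hx.1
    have h1 := hx.2 (v j) (hmem j)
    rw [edgeFunctional_eq _ _ (∑ i, w i • v i), orientedArea_sum _ _ _ hw1] at h1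
    have h2 : ∑ i, w i * slack v i j = 0 :=
      le_antisymm (by unfold slack; linarith)
        (Finset.sum_nonneg fun i _ => mul_nonneg (hw i) (slack_nonneg h i j))
    rw [Finset.sum_eq_zero_iff_of_nonneg fun i _ => mul_nonneg (hw i) (slack_nonneg h i j)] at h2
    have h3 : ∀ i, i ≠ j → i ≠ finRotate n j → w i = 0 := fun i hi hi' =>
      (mul_eq_zero.1 (h2 i (Finset.mem_univ i))).resolve_right (h i j hi hi').ne'
    -- No lower bound on `n` is assumed here, so the edge may degenerate to a point.
    rcases eq_or_ne j (finRotate n j) with hj | hj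
    · have e : ∀ i, i ≠ j → w i = 0 := fun i hi => h3 i hi (hj ▸ hi)
      rw [Finset.sum_eq_single j (fun i _ hi => e i hi) (by simp)] at hw1
      rw [Finset.sum_eq_single j (fun i _ hi => by rw [e i hi, zero_smul]) (by simp), hw1, one_smul]
      exact left_mem_segment ℝ _ _
    · rw [Finset.sum_eq_add j (finRotate n j) hj (fun i _ hi => h3 i hi.1 hi.2)
        (by simp) (by simp)] at hw1
      rw [Finset.sum_eq_add j (finRotate n j) hj
        (fun i _ hi => by rw [h3 i hi.1 hi.2, zero_smul]) (by simp) (by simp)]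
      exact ⟨_, _, hw _, hw _, hw1, rfl⟩

theorem isProperSequence_of_slack_pos {n : ℕ} (hn : 3 ≤ n) {v : Fin n → Plane}
    (h : ∀ i j, i ≠ j → i ≠ finRotate n j → 0 < slack v i j) : IsProperSequence v := by
  refine ⟨injective_of_slack_pos hn h, ⟨hn, ?_⟩, isExposed_edge_of_slack_pos h⟩
  have h1 := h ⟨0, by omega⟩ ⟨1, by omega⟩ (by simp)
  have e : finRotate n ⟨1, by omega⟩ = ⟨2, by omega⟩ := by
    apply Fin.ext
    rw [val_finRotate]
    simp
    omega
  rw [slack, e] at h1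
  exact h1 (by simp)

/-- The members of a proper sequence lie strictly on one side of each edge not containing them. -/
theorem IsProperSequence.exists_sign {n : ℕ} {v : Fin n → Plane} (hv : IsProperSequence v)
    (j : Fin n) : ∃ c : ℝ, ∀ i, i ≠ j → i ≠ finRotate n j → 0 < c * slack v i j := by
  obtain ⟨hinj, ⟨hn, -⟩, hexp⟩ := hv
  have hmem : ∀ i, v i ∈ convexHull ℝ (Set.range v) :=
    fun i => subset_convexHull ℝ _ (Set.mem_range_self i)
  have hface : ∀ j, ∃ l : Plane →L[ℝ] ℝ, l (v (finRotate n j)) = l (v j) ∧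
      (∀ i, l (v i) ≤ l (v j)) ∧
      ∀ i, l (v i) = l (v j) → v i ∈ segment ℝ (v j) (v (finRotate n j)) := by
    intro j
    obtain ⟨l, hl⟩ := hexp j ⟨_, left_mem_segment ℝ _ _⟩
    have h1 : v j ∈ segment ℝ (v j) (v (finRotate n j)) := left_mem_segment ℝ _ _
    have h2 : v (finRotate n j) ∈ segment ℝ (v j) (v (finRotate n j)) := right_mem_segment ℝ _ _
    rw [hl] at h1 h2
    refine ⟨l, le_antisymm (h1.2 _ (hmem _)) (h2.2 _ (hmem _)), fun i => h1.2 _ (hmem i),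
      fun i hi => ?_⟩
    rw [hl]
    exact ⟨hmem i, fun y hy => (h1.2 y hy).trans hi.ge⟩
  -- If `v i` were inside the edge `j`, the functional exposing the edge `i` would be maximal at
  -- both ends of the edge `j`. Both ends would then lie on one ray from `v i`, although `v i` is
  -- strictly between them.
  have hnot : ∀ i, i ≠ j → i ≠ finRotate n j → v i ∉ segment ℝ (v j) (v (finRotate n j)) := by
    rintro i hij hij' ⟨a, b, ha, hb, hab, he⟩
    obtain ⟨l, -, hl2, hl3⟩ := hface i
    have ha' : 0 < a := by
      refine ha.lt_of_ne fun h => hij' (hinj ?_)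
      rw [← he, ← h, show b = 1 by linarith]
      simp
    have hb' : 0 < b := by
      refine hb.lt_of_ne fun h => hij (hinj ?_)
      rw [← he, ← h, show a = 1 by linarith]
      simp
    have e1 : l (v i) = a * l (v j) + b * l (v (finRotate n j)) := by
      rw [← he]; simp
    have i1 := hl2 j
    have i2 := hl2 (finRotate n j)
    have q0 : a * (l (v i) - l (v j)) + b * (l (v i) - l (v (finRotate n j))) = 0 := by
      linear_combination l (v i) * hab + e1
    obtain ⟨q1, q2⟩ := (add_eq_zero_iff_of_nonneg (mul_nonneg ha (sub_nonneg.2 i1))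
      (mul_nonneg hb (sub_nonneg.2 i2))).1 q0
    replace q1 : l (v j) = l (v i) :=
      (sub_eq_zero.1 ((mul_eq_zero.1 q1).resolve_left ha'.ne')).symm
    replace q2 : l (v (finRotate n j)) = l (v i) :=
      (sub_eq_zero.1 ((mul_eq_zero.1 q2).resolve_left hb'.ne')).symm
    obtain ⟨a1, b1, ha1, hb1, hab1, he1⟩ := hl3 _ q1
    obtain ⟨a2, b2, ha2, hb2, hab2, he2⟩ := hl3 _ q2
    have q3 : (a * b1 + b * b2) • (v (finRotate n i) - v i) = 0 := by
      have e1 : v j = v i + b1 • (v (finRotate n i) - v i) := by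
        rw [← he1, show a1 = 1 - b1 by linarith]
        module
      have e2 : v (finRotate n j) = v i + b2 • (v (finRotate n i) - v i) := by
        rw [← he2, show a2 = 1 - b2 by linarith]
        module
      have e3 : v i = v i + (a * b1 + b * b2) • (v (finRotate n i) - v i) := by
        conv_lhs => rw [← he, e1, e2, show a = 1 - b by linarith]
        rw [show a = 1 - b by linarith]
        module
      simpa using e3
    rcases smul_eq_zero.1 q3 with q4 | q4
    · have : b1 = 0 := by nlinarith [mul_nonneg ha hb1, mul_nonneg hb hb2]
      apply hij
      apply hinj
      rw [← he1, this, show a1 = 1 by linarith]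
      simp
    · exact finRotate_ne_self (by omega) i (hinj (sub_eq_zero.1 q4))
  obtain ⟨l, hl1, hl2, hl3⟩ := hface j
  have hne : v (finRotate n j) ≠ v j := fun h => finRotate_ne_self (by omega) j (hinj h)
  set p := l (EuclideanSpace.single 0 1) with hp
  set q := l (EuclideanSpace.single 1 1) with hq
  have hl : ∀ x : Plane, l x = p * x 0 + q * x 1 := by
    intro x
    have : x = x 0 • EuclideanSpace.single 0 (1 : ℝ) + x 1 • EuclideanSpace.single 1 (1 : ℝ) := by
      ext i; fin_cases i <;> simp
    conv_lhs => rw [this]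
    simp [hp, hq, mul_comm]
  set e0 := v (finRotate n j) 0 - v j 0 with he0
  set e1 := v (finRotate n j) 1 - v j 1 with he1
  have hE : 0 < e0 ^ 2 + e1 ^ 2 := by
    by_contra hcon
    apply hne
    have h0 : e0 = 0 := by nlinarith [sq_nonneg e0, sq_nonneg e1]
    have h1 : e1 = 0 := by nlinarith [sq_nonneg e0, sq_nonneg e1]
    ext i
    fin_cases i
    · exact sub_eq_zero.1 h0
    · exact sub_eq_zero.1 h1
  have hpq : p * e0 + q * e1 = 0 := by
    rw [hl, hl] at hl1
    rw [he0, he1]; linarith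
  -- The exposing functional is orthogonal to the edge, hence a multiple of the slack; this is the
  -- multiplier up to a positive factor.
  refine ⟨q * e0 - p * e1, fun i hi hi' => ?_⟩
  have hlt : l (v i) < l (v j) := (hl2 i).lt_of_ne fun h => hnot i hi hi' (hl3 i h)
  have key : (q * e0 - p * e1) * slack v i j = (e0 ^ 2 + e1 ^ 2) * (l (v j) - l (v i)) := by
    have : slack v i j = (v i 0 - v j 0) * e1 - (v i 1 - v j 1) * e0 := rfl
    rw [this, hl, hl]
    linear_combination ((v i 0 - v j 0) * e0 + (v i 1 - v j 1) * e1) * hpq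
  rw [key]
  exact mul_pos hE (sub_pos.2 hlt)

/-- Adjacent edges share a triangle, the one on three consecutive points, so their signs agree; the
positive first triangle fixes the sign all around. -/
theorem IsProperSequence.slack_pos {n : ℕ} {v : Fin n → Plane} (hv : IsProperSequence v) :
    ∀ i j, i ≠ j → i ≠ finRotate n j → 0 < slack v i j := by
  choose c hc using hv.exists_sign
  obtain ⟨hn, h0⟩ := hv.2.1
  suffices hpos : ∀ j, 0 < c j from fun i j h1 h2 => pos_of_mul_pos_right (hc j i h1 h2) (hpos j).le
  have hstep : ∀ j, 0 < c j → 0 < c (finRotate n j) := by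
    intro j hj
    have hne := finRotate_ne_self (n := n) (by omega)
    have h1 := hc j _ (finRotate_finRotate_ne_self hn j) (hne _)
    have h2 := hc (finRotate n j) j (hne j).symm (finRotate_finRotate_ne_self hn j).symm
    have h3 : slack v (finRotate n (finRotate n j)) j = slack v j (finRotate n j) :=
      orientedArea_rotate _ _ _
    rw [h3] at h1
    exact pos_of_mul_pos_left h2 (pos_of_mul_pos_right h1 hj.le).le
  have h1 : 0 < c ⟨1, by omega⟩ := by
    have e : finRotate n ⟨1, by omega⟩ = ⟨2, by omega⟩ := by
      apply Fin.ext
      rw [val_finRotate]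
      simp
      omega
    have := hc ⟨1, by omega⟩ ⟨0, by omega⟩ (by simp) (by rw [e]; simp)
    rw [slack, e] at this
    exact pos_of_mul_pos_left this h0.le
  have h2 : ∀ m, 1 ≤ m → ∀ hm : m < n, 0 < c ⟨m, hm⟩ := by
    intro m hm
    induction m, hm using Nat.le_induction with
    | base => exact fun _ => h1
    | succ m hm ih =>
      intro hm'
      have e : finRotate n ⟨m, by omega⟩ = ⟨m + 1, hm'⟩ := by
        apply Fin.ext
        rw [val_finRotate]
        simp [hm']
      rw [← e]
      exact hstep _ (ih _)
  rintro ⟨j, hj⟩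
  rcases Nat.eq_zero_or_pos j with rfl | hj'
  · have e : finRotate n ⟨n - 1, by omega⟩ = ⟨0, hj⟩ := by
      apply Fin.ext
      rw [val_finRotate]
      simp
      omega
    rw [← e]
    exact hstep _ (h2 _ (by omega) _)
  · exact h2 j hj' hj

theorem isProperSequence_iff {n : ℕ} (hn : 3 ≤ n) {v : Fin n → Plane} :
    IsProperSequence v ↔ ∀ i j, i ≠ j → i ≠ finRotate n j → 0 < slack v i j :=
  ⟨fun h => h.slack_pos, isProperSequence_of_slack_pos hn⟩

/-! ### The slack matrix of an admissible sequence -/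

/-- Homogeneous coordinates of a point of the plane. -/
def homogenize (x : Plane) : Fin 3 → ℝ := ![1, x 1, x 0]

theorem tripleProduct_homogenize (a b c : Plane) :
    tripleProduct (homogenize a) (homogenize b) (homogenize c) = orientedArea a b c := by
  simp [tripleProduct, homogenize, orientedArea]; ring

theorem card_filter_le_val {n m : ℕ} :
    (Finset.univ.filter fun i : Fin n => m ≤ (i : ℕ)).card ≤ n - m := by
  rw [← Nat.card_Ico]
  exact Finset.card_le_card_of_injOn (fun i => (i : ℕ)) (fun i hi => by
    have := i.isLt
    simp at hi ⊢
    omega) (fun i _ j _ h => Fin.ext h)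

theorem card_filter_last_in_block {n k : ℕ} :
    (Finset.univ.filter fun i : Fin n => (i : ℕ) < k * k ∧ (i : ℕ) % k + 1 = k).card ≤ k := by
  conv_rhs => rw [← Finset.card_range k]
  refine Finset.card_le_card_of_injOn (fun i => (i : ℕ) / k) (fun i hi => ?_)
    (fun i hi j hj h => Fin.ext ?_)
  · simp at hi ⊢
    exact Nat.div_lt_of_lt_mul hi.1
  · simp at hi hj h
    rw [← Nat.div_add_mod' (i : ℕ) k, ← Nat.div_add_mod' (j : ℕ) k, h]
    omega

/-- Outside the blocks there are at most `2 * k` rows and, with the last column of each block, `3 *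
k` columns. With the `4 * k` terms of the blocks this makes `9 * k`. Below nine points one term per
row is enough. -/
theorem IsAdmissible.nonnegRankLE_slack {n : ℕ} {v : Fin n → Plane} (hv : IsAdmissible v) :
    NonnegRankLE (slack v) ⌊17 * √(n : ℝ)⌋₊ := by
  have hpos := hv.1.slack_pos
  rcases lt_or_ge n 9 with hn | hn
  · have h := NonnegRankLE.of_rows Finset.univ (slack_nonneg hpos)
    simp only [Finset.mem_univ, if_true, Finset.card_univ, Fintype.card_fin] at h
    refine h.mono (Nat.le_floor ?_)
    have h1 : √(n : ℝ) ≤ 17 := by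
      rw [Real.sqrt_le_left (by norm_num)]
      have : (n : ℝ) < 9 := by exact_mod_cast hn
      linarith
    have h2 := Real.mul_self_sqrt (Nat.cast_nonneg (α := ℝ) n)
    nlinarith [Real.sqrt_nonneg (n : ℝ)]
  set k := Nat.sqrt n with hk
  have hk3 : 3 ≤ k := Nat.le_sqrt.2 hn
  have hkn : k * k ≤ n := Nat.sqrt_le n
  have hnk : n < (k + 1) * (k + 1) := Nat.lt_succ_sqrt n
  set w : ℕ → Fin 3 → ℝ := fun i => if h : i < n then homogenize (v ⟨i, h⟩) else 0 with hw
  have hws : ∀ (i j : ℕ) (hi : i < n) (hj : j + 1 < n),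
      tripleProduct (w i) (w j) (w (j + 1)) = slack v ⟨i, hi⟩ ⟨j, by omega⟩ := by
    intro i j hi hj
    have e : finRotate n ⟨j, by omega⟩ = ⟨j + 1, hj⟩ := by
      apply Fin.ext
      rw [val_finRotate]
      simp [hj]
    simp only [hw]
    rw [dif_pos hi, dif_pos (show j < n by omega), dif_pos hj, tripleProduct_homogenize, slack, e]
  have hmain := nonnegRankLE_blocks (w := w) hk3
    (fun i j hi hj hij hij' => by
      rw [hws i j (by omega) (by omega)]
      refine hpos _ _ (by simpa using hij) fun h => hij' ?_
      have := congrArg Fin.val h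
      rw [val_finRotate, if_pos (show (j : ℕ) + 1 < n by omega)] at this
      exact this)
    (fun p q r t hq hp hc => by
      rw [hws q p (by omega) (by omega), hws t r (by omega) (by omega),
        hws t p (by omega) (by omega), hws q r (by omega) (by omega)]
      exact hv.2 ⟨p, by omega⟩ ⟨q, by omega⟩ ⟨r, by omega⟩ ⟨t, by omega⟩
        (show p + 1 < n by omega) hc)
  have h1 := NonnegRankLE.of_rows (Finset.univ.filter fun i : Fin n => k * k ≤ (i : ℕ))
    (slack_nonneg hpos)
  have h2 := NonnegRankLE.of_columns
    (Finset.univ.filter fun j : Fin n => ¬ ((j : ℕ) < k * k ∧ (j : ℕ) % k + 1 < k))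
    (M := fun (i j : Fin n) => if (i : ℕ) < k * k then slack v i j else 0)
    (fun i j => by
      split_ifs
      exacts [slack_nonneg hpos i j, le_rfl])
  have h3 := hmain.comap (fun i : Fin n => (i : ℕ)) (fun i : Fin n => (i : ℕ))
  have hsum := (h1.add h2).add h3
  have hcol : (Finset.univ.filter fun j : Fin n =>
      ¬ ((j : ℕ) < k * k ∧ (j : ℕ) % k + 1 < k)).card ≤ (n - k * k) + k := by
    refine (Finset.card_le_card (t := (Finset.univ.filter fun i : Fin n => k * k ≤ (i : ℕ)) ∪
      (Finset.univ.filter fun i : Fin n => (i : ℕ) < k * k ∧ (i : ℕ) % k + 1 = k)) ?_).trans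
      ((Finset.card_union_le _ _).trans
        (add_le_add card_filter_le_val card_filter_last_in_block))
    intro j hj
    have := Nat.mod_lt (j : ℕ) (show 0 < k by omega)
    simp only [Finset.mem_filter, Finset.mem_univ, true_and, Finset.mem_union] at hj ⊢
    omega
  have hcount : (Finset.univ.filter fun i : Fin n => k * k ≤ (i : ℕ)).card +
      (Finset.univ.filter fun j : Fin n =>
        ¬ ((j : ℕ) < k * k ∧ (j : ℕ) % k + 1 < k)).card + (k + k * 3) ≤ 9 * k := by
    have hrow := card_filter_le_val (n := n) (m := k * k)
    have : n ≤ k * k + 2 * k := by nlinarith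
    omega
  have hfloor : 9 * k ≤ ⌊17 * √(n : ℝ)⌋₊ := by
    refine Nat.le_floor ?_
    have h := Real.nat_sqrt_le_real_sqrt (a := n)
    push_cast
    have h0 := Real.sqrt_nonneg (n : ℝ)
    rw [← hk] at h
    linarith
  convert hsum.mono (hcount.trans hfloor) using 3 with i j
  by_cases hi : (i : ℕ) < k * k
  · by_cases hj : (j : ℕ) < k * k ∧ (j : ℕ) % k + 1 < k
    · have h4 : (j : ℕ) + 1 < n := by
        -- The closing column never occurs: when `n = k * k` it is the last column of the last
        -- block, which was removed.
        have h5 : (j : ℕ) + 1 ≠ k * k := by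
          intro h5
          have h6 : (j : ℕ) = (k - 1) * k + (k - 1) := by
            have : (k - 1 + 1) * k = (k - 1) * k + k := by ring
            rw [Nat.sub_add_cancel (by omega : 1 ≤ k)] at this
            omega
          rw [h6, Nat.mul_add_mod', Nat.mod_eq_of_lt (by omega : k - 1 < k)] at hj
          omega
        omega
      simp [hi, hj.1, hj.2, not_le.2 hi, not_le.2 hj.2, hws _ _ i.isLt h4]
    · simp only [Finset.mem_filter, Finset.mem_univ, true_and, hi, hj, not_le.2 hi, if_true,
        if_false, not_false_eq_true, zero_add, add_zero]
  · simp [hi, not_lt.1 hi]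

/-! ### The set of admissible sequences -/

theorem isAdmissible_iff {n : ℕ} (hn : 3 ≤ n) {v : Fin n → Plane} :
    IsAdmissible v ↔ (∀ i j, i ≠ j → i ≠ finRotate n j → 0 < slack v i j) ∧
      ∀ p q r t : Fin n, (p : ℕ) + 1 < n →
        ((r < p ∧ (r : ℕ) + 1 < (q : ℕ) ∧ t < r) ∨ (p < q ∧ r < p ∧ t < p)) →
          slack v q p * slack v t r < slack v t p * slack v q r := by
  rw [IsAdmissible, isProperSequence_iff hn]

theorem continuous_slack {n : ℕ} (i j : Fin n) :
    Continuous fun v : Fin n → Plane => slack v i j := by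
  unfold slack orientedArea
  fun_prop

theorem isOpen_setOf_isAdmissible {n : ℕ} (hn : 3 ≤ n) :
    IsOpen {v : Fin n → Plane | IsAdmissible v} := by
  simp only [isAdmissible_iff hn, Set.ofPred_and, Set.ofPred_forall]
  refine IsOpen.inter ?_ ?_
  · exact isOpen_iInter_of_finite fun i => isOpen_iInter_of_finite fun j =>
      isOpen_iInter_of_finite fun _ => isOpen_iInter_of_finite fun _ =>
        isOpen_lt continuous_const (continuous_slack i j)
  · exact isOpen_iInter_of_finite fun p => isOpen_iInter_of_finite fun q =>
      isOpen_iInter_of_finite fun r => isOpen_iInter_of_finite fun t =>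
        isOpen_iInter_of_finite fun _ => isOpen_iInter_of_finite fun _ =>
          isOpen_lt ((continuous_slack q p).mul (continuous_slack t r))
            ((continuous_slack t p).mul (continuous_slack q r))

theorem exists_isAdmissible {n : ℕ} (hn : 3 ≤ n) : ∃ v : Fin n → Plane, IsAdmissible v := by
  set x : ℕ → ℝ := fun i => 2 ^ i with hx
  have hx0 : ∀ i, 0 < x i := fun i => by positivity
  have hx1 : ∀ i, x (i + 1) = 2 * x i := fun i => by simp only [hx]; ring
  have hxm : ∀ {i j}, i ≤ j → x i ≤ x j := fun h => pow_le_pow_right₀ one_le_two h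
  have hxd : ∀ {i j}, i < j → 2 * x i ≤ x j := fun {i j} h => by
    rw [← hx1]; exact hxm h
  set v : Fin n → Plane := fun i => !₂[x i ^ 2, x i] with hv
  have area : ∀ i j l, orientedArea (v i) (v j) (v l) =
      (x i - x j) * (x l - x j) * (x i - x l) := by
    intro i j l
    simp [hv, orientedArea]
    ring
  have hslack : ∀ i j : Fin n, (j : ℕ) + 1 < n →
      slack v i j = x j * ((x i - x j) * (x i - 2 * x j)) := by
    intro i j hj
    rw [slack, area, val_finRotate, if_pos hj, hx1]
    ring
  refine ⟨v, (isAdmissible_iff hn).2 ⟨fun i j hij hij' => ?_, fun p q r t hp hc => ?_⟩⟩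
  · have h1 : (i : ℕ) ≠ j := fun h => hij (Fin.ext h)
    have h2 : (i : ℕ) ≠ (finRotate n j : ℕ) := fun h => hij' (Fin.ext h)
    rw [val_finRotate] at h2
    rcases lt_or_ge ((j : ℕ) + 1) n with hj | hj
    · rw [hslack i j hj]
      rw [if_pos hj] at h2
      refine mul_pos (hx0 _) ?_
      rcases lt_or_gt_of_ne h1 with h | h
      · have := hxd h
        have := hx0 i
        have := hx0 j
        exact mul_pos_of_neg_of_neg (by linarith) (by linarith)
      · have h3 := hxd (show (j : ℕ) + 1 < i by omega)
        rw [hx1] at h3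
        have := hx0 j
        exact mul_pos (by linarith) (by linarith)
    · rw [if_neg (by omega)] at h2
      have hi := i.isLt
      rw [slack, area, val_finRotate, if_neg (by omega)]
      have h3 := hxd (show (i : ℕ) < j by omega)
      have h4 := hxd (show 0 < (i : ℕ) by omega)
      have := hx0 0
      exact mul_pos (mul_pos_of_neg_of_neg (by linarith) (by linarith)) (by linarith)
  · have hr : (r : ℕ) < p := by
      rcases hc with hc | hc
      · exact hc.1
      · exact hc.2.1
    rw [hslack q p hp, hslack t p hp, hslack q r (by omega), hslack t r (by omega)]
    -- Columns carry the common positive factors `x p` and `x r`, which cancel.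
    suffices h : ((x q - x p) * (x q - 2 * x p)) * ((x t - x r) * (x t - 2 * x r)) <
        ((x t - x p) * (x t - 2 * x p)) * ((x q - x r) * (x q - 2 * x r)) by
      have := mul_lt_mul_of_pos_left h (mul_pos (hx0 p) (hx0 r))
      linarith
    have hrp := hxd hr
    have hP := hx0 p
    have hQ := hx0 q
    have hR := hx0 r
    have hT := hx0 t
    -- the factors belonging to the row `t`
    have rowT : 2 * x t ≤ x p →
        (x t - x r) * (x t - 2 * x r) < (x t - x p) * (x t - 2 * x p) := by
      intro h
      nlinarith
    -- the factors belonging to the row `q`, when `q` comes after `p`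
    have rowQ : 2 * x p ≤ x q →
        (x q - x p) * (x q - 2 * x p) < (x q - x r) * (x q - 2 * x r) := by
      intro h
      nlinarith
    have after : 2 * x p ≤ x q → 2 * x t ≤ x p →
        ((x q - x p) * (x q - 2 * x p)) * ((x t - x r) * (x t - 2 * x r)) <
        ((x t - x p) * (x t - 2 * x p)) * ((x q - x r) * (x q - 2 * x r)) := by
      intro h1 h2
      have h3 : 0 ≤ (x q - x p) * (x q - 2 * x p) := mul_nonneg (by linarith) (by linarith)
      have h4 : 0 < (x t - x p) * (x t - 2 * x p) :=
        mul_pos_of_neg_of_neg (by linarith) (by linarith)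
      calc _ ≤ ((x q - x p) * (x q - 2 * x p)) * ((x t - x p) * (x t - 2 * x p)) :=
            mul_le_mul_of_nonneg_left (rowT h2).le h3
        _ < ((x q - x r) * (x q - 2 * x r)) * ((x t - x p) * (x t - 2 * x p)) :=
            mul_lt_mul_of_pos_right (rowQ h1) h4
        _ = _ := mul_comm _ _
    rcases hc with ⟨-, hrq, htr⟩ | ⟨hpq, -, htp⟩
    · have hTR := hxd (show (t : ℕ) < r from htr)
      have hRQ := hxd hrq
      rw [hx1] at hRQ
      -- Here `r + 1 < q` gives `4 * x r ≤ x q`, so the factor of row `q` at `r` also exceeds that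
      -- of row `t`.
      have posQ : 0 < (x q - x r) * (x q - 2 * x r) := mul_pos (by linarith) (by linarith)
      rcases lt_trichotomy (q : ℕ) p with hqp | hqp | hpq
      · have hQP := hxd hqp
        have h1 : (x q - x p) * (x q - 2 * x p) ≤ (x t - x p) * (x t - 2 * x p) := by nlinarith
        have h2 : (x t - x r) * (x t - 2 * x r) < (x q - x r) * (x q - 2 * x r) := by nlinarith
        have h3 : 0 < (x q - x p) * (x q - 2 * x p) :=
          mul_pos_of_neg_of_neg (by linarith) (by linarith)
        exact (mul_lt_mul_of_pos_left h2 h3).trans_le (mul_le_mul_of_nonneg_right h1 posQ.le)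
      · rw [hqp, sub_self, zero_mul, zero_mul, ← hqp]
        exact mul_pos (mul_pos_of_neg_of_neg (by rw [hqp]; linarith) (by rw [hqp]; linarith)) posQ
      · exact after (hxd hpq) (by linarith)
    · exact after (hxd hpq) (hxd htp)

/-! ### Polyhedra in standard form -/

section Polyhedron

variable {d r : ℕ}

/-- The polyhedron cut out of an affine subspace by the nonnegativity of linear functionals. -/
def standardPolyhedron (H : AffineSubspace ℝ (EuclideanSpace ℝ (Fin d)))
    (g : Fin r → EuclideanSpace ℝ (Fin d) →ₗ[ℝ] ℝ) : Set (EuclideanSpace ℝ (Fin d)) :=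
  {z | z ∈ H ∧ ∀ l, 0 ≤ g l z}

variable {H : AffineSubspace ℝ (EuclideanSpace ℝ (Fin d))}
  {g : Fin r → EuclideanSpace ℝ (Fin d) →ₗ[ℝ] ℝ}

theorem convex_standardPolyhedron : Convex ℝ (standardPolyhedron H g) := by
  intro x hx y hy a b ha hb hab
  refine ⟨H.convex hx.1 hy.1 ha hb hab, fun l => ?_⟩
  simp only [map_add, map_smul, smul_eq_mul]
  exact add_nonneg (mul_nonneg ha (hx.2 l)) (mul_nonneg hb (hy.2 l))

theorem isClosed_standardPolyhedron : IsClosed (standardPolyhedron H g) := by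
  have h : standardPolyhedron H g = (H : Set _) ∩ ⋂ l, {z | 0 ≤ g l z} := by
    ext z; simp [standardPolyhedron]
  rw [h]
  exact (AffineSubspace.closed_of_finiteDimensional H).inter
    (isClosed_iInter fun l =>
      isClosed_le continuous_const (LinearMap.continuous_of_finiteDimensional (g l)))

/-- All constraints tight at `z` are tight at `q`, and the others leave room, so the segment from
`q` can be prolonged a little beyond `z`. -/
theorem exists_extend_in_standardPolyhedron {z q : EuclideanSpace ℝ (Fin d)}
    (hz : z ∈ standardPolyhedron H g) (hq : q ∈ standardPolyhedron H g)
    (hzq : ∀ l, g l z = 0 → g l q = 0) :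
    ∃ ε : ℝ, 0 < ε ∧ z + ε • (z - q) ∈ standardPolyhedron H g := by
  -- `S` bounds every ratio; terms with `g l z = 0` are zero by the convention on division.
  set S := ∑ l, g l q / g l z with hS
  have hterm : ∀ l, 0 ≤ g l q / g l z := fun l => div_nonneg (hq.2 l) (hz.2 l)
  have hS0 : 0 ≤ S := Finset.sum_nonneg fun l _ => hterm l
  refine ⟨(1 + S)⁻¹, by positivity, ?_, fun l => ?_⟩
  · have := H.smul_vsub_vadd_mem (1 + S)⁻¹ hz.1 hq.1 hz.1
    rwa [vsub_eq_sub, vadd_eq_add, add_comm] at this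
  · have h : (1 + S)⁻¹ * g l q ≤ g l z := by
      rcases (hz.2 l).eq_or_lt with h0 | h0
      · rw [← h0, hzq l h0.symm, mul_zero]
      · rw [inv_mul_le_iff₀ (by positivity)]
        have h1 : g l q / g l z ≤ S :=
          Finset.single_le_sum (f := fun l => g l q / g l z) (fun l _ => hterm l)
            (Finset.mem_univ l)
        rw [div_le_iff₀ h0] at h1
        linarith
    have h2 : 0 ≤ (1 + S)⁻¹ * g l z := mul_nonneg (by positivity) (hz.2 l)
    simp only [map_add, map_smul, map_sub, smul_eq_mul]
    linarith

/-- An extreme point is determined by its set of tight constraints: prolonging the segment from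
another such point would put it in the interior of a segment. -/
theorem finite_extremePoints_standardPolyhedron :
    ((standardPolyhedron H g).extremePoints ℝ).Finite := by
  refine Set.Finite.of_finite_image (f := fun z => {l | g l z = 0}) (Set.toFinite _) ?_
  intro z hz q hq hzq
  have hzq' : ∀ l, g l z = 0 → g l q = 0 := fun l hl => by
    have : l ∈ {l | g l z = 0} := hl
    rwa [show {l | g l z = 0} = {l | g l q = 0} from hzq] at this
  obtain ⟨ε, hε, hmem⟩ := exists_extend_in_standardPolyhedron hz.1 hq.1 hzq'
  refine (mem_extremePoints.1 hz).2 q hq.1 _ hmem ?_ |>.1.symm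
  refine ⟨ε / (1 + ε), 1 / (1 + ε), by positivity, by positivity, by field_simp; ring, ?_⟩
  have h1 : ε / (1 + ε) = 1 - 1 / (1 + ε) := by field_simp; ring
  have h2 : 1 / (1 + ε) * ε = 1 - 1 / (1 + ε) := by field_simp; ring
  rw [smul_add, smul_smul, h2, h1]
  module

theorem isPolytope_standardPolyhedron (hb : Bornology.IsBounded (standardPolyhedron H g)) :
    IsPolytope (standardPolyhedron H g) := by
  refine ⟨_, finite_extremePoints_standardPolyhedron (H := H) (g := g), ?_⟩
  rw [← ((finite_extremePoints_standardPolyhedron (H := H) (g := g)).isClosed_convexHull ℝ).closure_eq]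
  exact (closure_convexHull_extremePoints
    (Metric.isCompact_of_isClosed_isBounded isClosed_standardPolyhedron hb)
    convex_standardPolyhedron).symm

/-- Averaging with a point where a functional is positive removes that functional from the tight
ones and adds none. -/
theorem exists_relative_interior_point {F : Set (EuclideanSpace ℝ (Fin d))} (hF : Convex ℝ F)
    (hne : F.Nonempty) (hg : ∀ l, ∀ f ∈ F, 0 ≤ g l f) :
    ∃ z ∈ F, ∀ l, g l z = 0 → ∀ f ∈ F, g l f = 0 := by
  suffices h : ∀ s : Finset (Fin r), ∃ z ∈ F, ∀ l ∈ s, g l z = 0 → ∀ f ∈ F, g l f = 0 by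
    obtain ⟨z, hz, hz'⟩ := h Finset.univ
    exact ⟨z, hz, fun l => hz' l (Finset.mem_univ l)⟩
  intro s
  induction s using Finset.induction_on with
  | empty =>
    obtain ⟨z, hz⟩ := hne
    exact ⟨z, hz, by simp⟩
  | insert a s _ ih =>
    obtain ⟨z, hz, hzs⟩ := ih
    by_cases hex : ∃ f ∈ F, g a f ≠ 0
    · obtain ⟨f, hf, hfa⟩ := hex
      refine ⟨(1 / 2 : ℝ) • z + (1 / 2 : ℝ) • f,
        hF hz hf (by norm_num) (by norm_num) (by norm_num), fun l hl h0 => ?_⟩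
      simp only [map_add, map_smul, smul_eq_mul] at h0
      have h1 := hg l z hz
      have h2 := hg l f hf
      rcases Finset.mem_insert.1 hl with rfl | hl
      · exact absurd (by linarith) hfa
      · exact hzs l hl (by linarith)
    · push Not at hex
      refine ⟨z, hz, fun l hl h0 => ?_⟩
      rcases Finset.mem_insert.1 hl with rfl | hl
      · exact hex
      · exact hzs l hl h0

theorem vectorSpan_le_ker {F : Set (EuclideanSpace ℝ (Fin d))} {z : EuclideanSpace ℝ (Fin d)}
    {f : EuclideanSpace ℝ (Fin d) →ₗ[ℝ] ℝ} (h : ∀ x ∈ F, f x = f z) :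
    vectorSpan ℝ F ≤ LinearMap.ker f := by
  rw [vectorSpan_def, Submodule.span_le]
  rintro _ ⟨a, ha, b, hb, rfl⟩
  simp [h a ha, h b hb]

/-- If a constraint tight on the facet is not tight on the whole polyhedron, its face has the
dimension of the facet and therefore equals it. If no such constraint exists, a relative interior
point of the facet is interior to the polyhedron and the facet would be everything. -/
theorem IsFacet.exists_eq {F : Set (EuclideanSpace ℝ (Fin d))}
    (hF : IsFacet (standardPolyhedron H g) F) :
    ∃ l, F = {z ∈ standardPolyhedron H g | g l z = 0} := by
  obtain ⟨hexp, hne, hdim⟩ := hF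
  obtain ⟨φ, hφ⟩ := hexp hne
  have hFQ : F ⊆ standardPolyhedron H g := hexp.subset
  obtain ⟨z, hz, hzg⟩ := exists_relative_interior_point (g := g)
    (hexp.convex convex_standardPolyhedron) hne (fun l f hf => (hFQ hf).2 l)
  have hzmax : ∀ y ∈ standardPolyhedron H g, φ y ≤ φ z := by
    rw [hφ] at hz
    exact hz.2
  have hmemF : ∀ y ∈ standardPolyhedron H g, φ y = φ z → y ∈ F := by
    intro y hy hyz
    rw [hφ]
    exact ⟨hy, fun q hq => (hzmax q hq).trans hyz.ge⟩
  have hFφ : ∀ y ∈ F, φ y = φ z := by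
    intro y hy
    have hy' := hy
    rw [hφ] at hy'
    exact le_antisymm (hzmax y hy'.1) (hy'.2 z (hFQ hz))
  by_contra! hcon
  have claim : ∀ l, g l z = 0 → ∀ q ∈ standardPolyhedron H g, g l q = 0 := by
    intro l hl q hq
    by_contra hql
    have hFG : F ⊆ {z ∈ standardPolyhedron H g | g l z = 0} :=
      fun f hf => ⟨hFQ hf, hzg l hl f hf⟩
    have hGker : vectorSpan ℝ {z ∈ standardPolyhedron H g | g l z = 0} ≤ LinearMap.ker (g l) :=
      vectorSpan_le_ker (z := z) fun x hx => by rw [hx.2, hl]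
    have hlt : vectorSpan ℝ {z ∈ standardPolyhedron H g | g l z = 0} <
        vectorSpan ℝ (standardPolyhedron H g) := by
      refine lt_of_le_of_ne (vectorSpan_mono ℝ fun x hx => hx.1) fun heq => hql ?_
      have h1 : q - z ∈ vectorSpan ℝ (standardPolyhedron H g) :=
        vsub_mem_vectorSpan ℝ hq (hFQ hz)
      rw [← heq] at h1
      have h2 := hGker h1
      rw [LinearMap.mem_ker, map_sub, hl, sub_zero] at h2
      exact h2
    have hfin := Submodule.finrank_lt_finrank_of_lt hlt
    have heq := Submodule.eq_of_le_of_finrank_le (vectorSpan_mono ℝ hFG) (by omega)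
    refine hcon l (hFG.antisymm fun w hw => hmemF w hw.1 ?_)
    have h1 : w - z ∈ vectorSpan ℝ {z ∈ standardPolyhedron H g | g l z = 0} :=
      vsub_mem_vectorSpan ℝ hw ⟨hFQ hz, hl⟩
    rw [← heq] at h1
    have h2 := vectorSpan_le_ker (f := (φ : EuclideanSpace ℝ (Fin d) →ₗ[ℝ] ℝ)) hFφ h1
    rw [LinearMap.mem_ker, map_sub] at h2
    exact sub_eq_zero.1 h2
  have hFeq : F = standardPolyhedron H g := by
    refine hFQ.antisymm fun q hq => hmemF q hq (le_antisymm (hzmax q hq) ?_)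
    obtain ⟨ε, hε, hmem⟩ := exists_extend_in_standardPolyhedron (hFQ hz) hq
      (fun l hl => claim l hl q hq)
    have := hzmax _ hmem
    simp only [map_add, map_smul, map_sub, smul_eq_mul] at this
    nlinarith
  rw [hFeq] at hdim
  omega

theorem encard_facets_standardPolyhedron_le :
    {F | IsFacet (standardPolyhedron H g) F}.encard ≤ r := by
  have h : {F | IsFacet (standardPolyhedron H g) F} ⊆
      (fun l => {z ∈ standardPolyhedron H g | g l z = 0}) '' (Set.univ : Set (Fin r)) := by
    intro F hF
    obtain ⟨l, hl⟩ := hF.exists_eq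
    exact ⟨l, Set.mem_univ l, hl.symm⟩
  refine (Set.encard_le_encard h).trans ((Set.encard_image_le _ _).trans ?_)
  simp

end Polyhedron

/-! ### From nonnegative rank to extension complexity -/

/-- A convex polygon is the intersection of the half-planes of its edges. -/
theorem mem_convexHull_of_orientedArea_nonneg {n : ℕ} (hn : 3 ≤ n) {v : Fin n → Plane}
    (h : ∀ i j, i ≠ j → i ≠ finRotate n j → 0 < slack v i j) {x : Plane}
    (hx : ∀ j, 0 ≤ orientedArea x (v j) (v (finRotate n j))) :
    x ∈ convexHull ℝ (Set.range v) := by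
  set u : ℕ → Plane := fun k => if hk : k < n then v ⟨k, hk⟩ else 0 with hu
  have hu' : ∀ k (hk : k < n), u k = v ⟨k, hk⟩ := fun k hk => dif_pos hk
  have hedge : ∀ k, k + 1 < n → 0 ≤ orientedArea x (u k) (u (k + 1)) := by
    intro k hk
    have e : finRotate n ⟨k, by omega⟩ = ⟨k + 1, hk⟩ := by
      apply Fin.ext
      rw [val_finRotate]
      simp [hk]
    have := hx ⟨k, by omega⟩
    rwa [e, ← hu', ← hu'] at this
  have hlast : orientedArea x (u 0) (u (n - 1)) ≤ 0 := by
    have e : finRotate n ⟨n - 1, by omega⟩ = ⟨0, by omega⟩ := by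
      apply Fin.ext
      rw [val_finRotate]
      simp
      omega
    have := hx ⟨n - 1, by omega⟩
    rw [e, ← hu', ← hu'] at this
    unfold orientedArea at this ⊢
    linarith
  -- In the fan of triangles from `u 0`, the side of `x` relative to the diagonals changes at some
  -- `k`; the coefficients below are the barycentric coordinates in that triangle.
  obtain ⟨k, hk1, hk2, hk3, hk4⟩ : ∃ k, 1 ≤ k ∧ k + 1 < n ∧ 0 ≤ orientedArea x (u 0) (u k) ∧
      orientedArea x (u 0) (u (k + 1)) ≤ 0 := by
    by_contra! hcon
    have : ∀ k, 2 ≤ k → k < n → 0 < orientedArea x (u 0) (u k) := by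
      intro k hk
      induction k, hk using Nat.le_induction with
      | base => exact fun _ => hcon 1 le_rfl (by omega) (hedge 0 (by omega))
      | succ k hk ih => exact fun hk' => hcon k (by omega) hk' (ih (by omega)).le
    exact absurd (this (n - 1) (by omega) (by omega)) (not_lt.2 hlast)
  have hpos : 0 < orientedArea (u 0) (u k) (u (k + 1)) := by
    have e : finRotate n ⟨k, by omega⟩ = ⟨k + 1, hk2⟩ := by
      apply Fin.ext
      rw [val_finRotate]
      simp [hk2]
    have := h ⟨0, by omega⟩ ⟨k, by omega⟩ (by simp; omega) (by rw [e]; simp)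
    rwa [slack, e, ← hu', ← hu', ← hu'] at this
  have hmem : ∀ k, k < n → u k ∈ convexHull ℝ (Set.range v) := fun k hk => by
    rw [hu' k hk]
    exact subset_convexHull ℝ _ (Set.mem_range_self _)
  set T := orientedArea (u 0) (u k) (u (k + 1)) with hT
  have hx' : x = ∑ i : Fin 3, (![orientedArea x (u k) (u (k + 1)) / T,
      -orientedArea x (u 0) (u (k + 1)) / T, orientedArea x (u 0) (u k) / T] i) •
      (![u 0, u k, u (k + 1)] i) := by
    rw [Fin.sum_univ_three]
    ext c
    have hT0 := hpos.ne'
    fin_cases c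
    · simp
      field_simp
      rw [hT]
      simp only [orientedArea]
      ring
    · simp
      field_simp
      rw [hT]
      simp only [orientedArea]
      ring
  rw [hx']
  refine (convex_convexHull ℝ _).sum_mem (fun i _ => ?_) ?_ (fun i _ => ?_)
  · fin_cases i
    · exact div_nonneg (hedge k hk2) hpos.le
    · exact div_nonneg (neg_nonneg.2 hk4) hpos.le
    · exact div_nonneg hk3 hpos.le
  · rw [Fin.sum_univ_three]
    simp
    field_simp
    rw [hT]
    simp only [orientedArea]
    ring
  · fin_cases i
    · exact hmem 0 (by omega)
    · exact hmem k (by omega)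
    · exact hmem (k + 1) hk2

/-- The projection of `ℝ^(k + r)` onto the first `k` coordinates. -/
def projFirst (k r : ℕ) : EuclideanSpace ℝ (Fin (k + r)) →ₗ[ℝ] EuclideanSpace ℝ (Fin k) where
  toFun z := WithLp.toLp 2 fun i => z (Fin.castAdd r i)
  map_add' x y := by ext; simp
  map_smul' c x := by ext; simp

theorem projFirst_apply {k r : ℕ} (z : EuclideanSpace ℝ (Fin (k + r))) (i : Fin k) :
    projFirst k r z i = z (Fin.castAdd r i) := rfl

/-- The `l`-th of the last `r` coordinates of `ℝ^(k + r)`. -/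
def lastCoord (k : ℕ) {r : ℕ} (l : Fin r) : EuclideanSpace ℝ (Fin (k + r)) →ₗ[ℝ] ℝ where
  toFun z := z (Fin.natAdd k l)
  map_add' x y := by simp
  map_smul' c x := by simp

theorem lastCoord_apply {k r : ℕ} (l : Fin r) (z : EuclideanSpace ℝ (Fin (k + r))) :
    lastCoord k l z = z (Fin.natAdd k l) := rfl

/-- The affine subspace of `ℝ^(2 + r)` on which the slacks of the first two coordinates are given
by the last `r` coordinates through the columns of `B`. -/
def slackSubspace {n r : ℕ} (v : Fin n → Plane) (B : Fin r → Fin n → ℝ) :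
    AffineSubspace ℝ (EuclideanSpace ℝ (Fin (2 + r))) where
  carrier := {z | (∀ j, orientedArea (projFirst 2 r z) (v j) (v (finRotate n j)) =
      ∑ l, lastCoord 2 l z * B l j) ∧ ∀ l, (∀ j, B l j = 0) → lastCoord 2 l z = 0}
  smul_vsub_vadd_mem' := by
    rintro c p q s ⟨hp, hp'⟩ ⟨hq, hq'⟩ ⟨hs, hs'⟩
    refine ⟨fun j => ?_, fun l hl => ?_⟩
    · have e : orientedArea (projFirst 2 r (c • (p -ᵥ q) +ᵥ s)) (v j) (v (finRotate n j)) =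
          c * (orientedArea (projFirst 2 r p) (v j) (v (finRotate n j)) -
            orientedArea (projFirst 2 r q) (v j) (v (finRotate n j))) +
          orientedArea (projFirst 2 r s) (v j) (v (finRotate n j)) := by
        simp [orientedArea]
        ring
      rw [e, hp, hq, hs, ← Finset.sum_sub_distrib, Finset.mul_sum, ← Finset.sum_add_distrib]
      refine Finset.sum_congr rfl fun l _ => ?_
      simp
      ring
    · simp [hp' l hl, hq' l hl, hs' l hl]

theorem isBounded_of_coord_bounded {d : ℕ} {Q : Set (EuclideanSpace ℝ (Fin d))}
    (h : ∀ i, ∃ C : ℝ, ∀ z ∈ Q, |z i| ≤ C) : Bornology.IsBounded Q := by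
  choose C hC using h
  have h1 : Bornology.IsBounded (Set.univ.pi fun i => Set.Icc (-C i) (C i)) :=
    Bornology.IsBounded.pi fun i => Metric.isBounded_Icc _ _
  refine ((PiLp.antilipschitzWith_ofLp 2 (fun _ : Fin d => ℝ)).isBounded_preimage h1).subset ?_
  intro z hz i _
  exact abs_le.1 (hC i z hz)

/-- The upper bound in Yannakakis' theorem, for polygons. -/
theorem extensionComplexity_le_of_nonnegRankLE {n r : ℕ} (hn : 3 ≤ n) {v : Fin n → Plane}
    (h : ∀ i j, i ≠ j → i ≠ finRotate n j → 0 < slack v i j) (hr : NonnegRankLE (slack v) r) :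
    extensionComplexity (convexHull ℝ (Set.range v)) ≤ r := by
  obtain ⟨A, B, hA, hB, hAB⟩ := hr
  set Q := standardPolyhedron (slackSubspace v B) (fun l => lastCoord 2 l) with hQ
  have hproj : ∀ z ∈ Q, projFirst 2 r z ∈ convexHull ℝ (Set.range v) := by
    intro z hz
    refine mem_convexHull_of_orientedArea_nonneg hn h fun j => ?_
    rw [hz.1.1 j]
    exact Finset.sum_nonneg fun l _ => mul_nonneg (hz.2 l) (hB l j)
  have hcomp : IsCompact (convexHull ℝ (Set.range v)) := (Set.finite_range v).isCompact_convexHull ℝ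
  have hbdd : Bornology.IsBounded Q := by
    refine isBounded_of_coord_bounded fun i => ?_
    refine Fin.addCases (fun i => ?_) (fun l => ?_) i
    · obtain ⟨C, hC⟩ := hcomp.isBounded.exists_norm_le
      refine ⟨C, fun z hz => ?_⟩
      rw [← projFirst_apply, ← Real.norm_eq_abs]
      exact (PiLp.norm_apply_le _ i).trans (hC _ (hproj z hz))
    -- A coordinate that enters no slack is set to zero by the second condition of `slackSubspace`,
    -- since otherwise it would be unbounded; any other is bounded by a slack.
    · by_cases hl : ∀ j, B l j = 0
      · exact ⟨0, fun z hz => by rw [← lastCoord_apply, hz.1.2 l hl, abs_zero]⟩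
      · push Not at hl
        obtain ⟨j, hj⟩ := hl
        have hj' : 0 < B l j := (hB l j).lt_of_ne' hj
        have hcont : Continuous fun x : Plane => orientedArea x (v j) (v (finRotate n j)) := by
          unfold orientedArea; fun_prop
        obtain ⟨C, hC⟩ := hcomp.bddAbove_image hcont.continuousOn
        refine ⟨C / B l j, fun z hz => ?_⟩
        rw [← lastCoord_apply, abs_of_nonneg (hz.2 l), le_div_iff₀ hj']
        refine le_trans ?_ (hC ⟨_, hproj z hz, rfl⟩)
        dsimp only
        rw [hz.1.1 j]
        exact Finset.single_le_sum (f := fun l => lastCoord 2 l z * B l j)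
          (fun l _ => mul_nonneg (hz.2 l) (hB l j)) (Finset.mem_univ l)
  have himage : projFirst 2 r '' Q = convexHull ℝ (Set.range v) := by
    refine Set.Subset.antisymm (Set.image_subset_iff.2 hproj) ?_
    refine convexHull_min ?_ (convex_standardPolyhedron.linear_image _)
    rintro _ ⟨i, rfl⟩
    classical
    -- The vertex `v i` lifts to the row `A i`, with the unused coordinates replaced by zero.
    refine ⟨WithLp.toLp 2 (Fin.append (fun c => v i c)
      (fun l => if ∀ j, B l j = 0 then 0 else A i l)), ⟨⟨fun j => ?_, fun l hl => ?_⟩,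
        fun l => ?_⟩, ?_⟩
    · have e : projFirst 2 r (WithLp.toLp 2 (Fin.append (fun c => v i c)
          (fun l => if ∀ j, B l j = 0 then 0 else A i l))) = v i := by
        ext c
        simp [projFirst_apply]
      rw [e]
      refine (hAB i j).trans (Finset.sum_congr rfl fun l _ => ?_)
      simp only [lastCoord_apply, Fin.append_right]
      split_ifs with hl
      · rw [hl j, mul_zero, mul_zero]
      · rfl
    · simp [lastCoord_apply, hl]
    · simp only [lastCoord_apply, Fin.append_right]
      split_ifs
      exacts [le_rfl, hA i l]
    · ext c
      simp [projFirst_apply]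
  refine le_trans (sInf_le ⟨2 + r, Q, ⟨isPolytope_standardPolyhedron hbdd, projFirst 2 r, himage⟩,
    rfl⟩) encard_facets_standardPolyhedron_le

/-! ### Generic coordinates -/

/-- The zero set of a nonzero real polynomial is a null set. -/
theorem volume_setOf_eval_eq_zero {n : ℕ} {p : MvPolynomial (Fin n) ℝ} (hp : p ≠ 0) :
    volume {x : Fin n → ℝ | MvPolynomial.eval x p = 0} = 0 := by
  induction n with
  | zero =>
    have h : {x : Fin 0 → ℝ | MvPolynomial.eval x p = 0} = ∅ := by
      refine Set.eq_empty_of_forall_notMem fun x hx => hp ?_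
      rw [MvPolynomial.eq_C_of_isEmpty p] at hx ⊢
      have hx' : MvPolynomial.eval x (MvPolynomial.C (MvPolynomial.coeff 0 p)) = 0 := hx
      rw [MvPolynomial.eval_C] at hx'
      rw [hx', MvPolynomial.C_0]
    rw [h, measure_empty]
  | succ n ih =>
    set f := MvPolynomial.finSuccEquiv ℝ n p with hf
    have hf0 : f ≠ 0 := fun h =>
      hp ((MvPolynomial.finSuccEquiv ℝ n).injective (by rw [← hf, h, map_zero]))
    set Z : Set (ℝ × (Fin n → ℝ)) := {y | MvPolynomial.eval (Fin.cons y.1 y.2) p = 0} with hZ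
    have hZm : MeasurableSet Z := by
      have : Continuous fun y : ℝ × (Fin n → ℝ) =>
          MvPolynomial.eval (Fin.cons y.1 y.2 : Fin (n + 1) → ℝ) p :=
        (MvPolynomial.continuous_eval p).comp (by fun_prop)
      exact (isClosed_eq this continuous_const).measurableSet
    have hZ0 : volume Z = 0 := by
      rw [Measure.volume_eq_prod, Measure.measure_prod_null hZm]
      -- As a nonzero polynomial in the first variable over a domain, `f` has finitely many roots,
      -- so almost every slice is the zero set of a nonzero polynomial; then Fubini applies.
      have hfin : {y : ℝ | f.eval (MvPolynomial.C y) = 0}.Finite := by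
        have h1 : {q | f.IsRoot q}.Finite := Polynomial.finite_setOfPred_isRoot hf0
        exact h1.preimage (MvPolynomial.C_injective (Fin n) ℝ).injOn
      have hae : ∀ᵐ y : ℝ, f.eval (MvPolynomial.C y) ≠ 0 := by
        rw [ae_iff]
        simpa using hfin.measure_zero volume
      filter_upwards [hae] with y hy
      have h2 : Prod.mk y ⁻¹' Z = {s | MvPolynomial.eval s (f.eval (MvPolynomial.C y)) = 0} := by
        ext s
        simp only [hZ, Set.mem_preimage, Set.mem_ofPred_eq]
        rw [MvPolynomial.eval_eq_eval_mv_eval', Polynomial.eval_map, ← hf,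
          ← Polynomial.eval₂_at_apply, MvPolynomial.eval_C]
      rw [h2]
      exact ih hy
    have hmp := volume_preserving_piFinSuccAbove (fun _ : Fin (n + 1) => ℝ) 0
    rw [← hmp.measure_preimage hZm.nullMeasurableSet] at hZ0
    convert hZ0 using 2
    ext x
    have : (Fin.cons (x 0) fun j => x (Fin.succAbove 0 j) : Fin (n + 1) → ℝ) = x := by
      simpa [Fin.tail_def] using Fin.cons_self_tail x
    simp only [hZ, Set.mem_preimage, Set.mem_ofPred_eq]
    change _ ↔ MvPolynomial.eval (Fin.cons (x 0) fun j => x (Fin.succAbove 0 j)) p = 0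
    rw [this]

theorem countable_mvPolynomial_rat (n : ℕ) : Countable (MvPolynomial (Fin n) ℚ) := by
  rw [← Cardinal.mk_le_aleph0_iff]
  exact MvPolynomial.cardinalMk_le_max_lift.trans (by simp)

/-- There are only countably many rational polynomials, each nonzero one with a null zero set. -/
theorem ae_algebraicIndependent (n : ℕ) :
    ∀ᵐ x : Fin n → ℝ, AlgebraicIndependent ℚ x := by
  have := countable_mvPolynomial_rat n
  have h : ∀ᵐ x : Fin n → ℝ, ∀ p : MvPolynomial (Fin n) ℚ, p ≠ 0 → MvPolynomial.aeval x p ≠ 0 := by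
    rw [ae_all_iff]
    intro p
    by_cases hp : p = 0
    · exact Eventually.of_forall fun x h => absurd hp h
    have hp' : MvPolynomial.map (algebraMap ℚ ℝ) p ≠ 0 := fun h =>
      hp (MvPolynomial.map_injective _ (algebraMap ℚ ℝ).injective (by rw [h, map_zero]))
    have h0 := volume_setOf_eval_eq_zero hp'
    filter_upwards [compl_mem_ae_iff.2 h0] with x hx _ hx'
    refine hx ?_
    change MvPolynomial.eval x _ = 0
    rwa [MvPolynomial.eval_map, ← MvPolynomial.aeval_def]
  filter_upwards [h] with x hx
  rw [algebraicIndependent_iff]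
  intro p hp
  by_contra h0
  exact hx p h0 hp

/-- The list of the coordinates of `n` points of the plane. -/
def coordEquiv (n : ℕ) : (Fin n → Plane) ≃ₗ[ℝ] (Fin (n * 2) → ℝ) where
  toFun v k := v (finProdFinEquiv.symm k).1 (finProdFinEquiv.symm k).2
  invFun x i := WithLp.toLp 2 fun c => x (finProdFinEquiv (i, c))
  map_add' _ _ := rfl
  map_smul' _ _ := rfl
  left_inv v := by ext i c; simp
  right_inv x := by
    ext k
    change x (finProdFinEquiv (finProdFinEquiv.symm k)) = x k
    rw [Equiv.apply_symm_apply]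

theorem ae_algebraicIndependent_coords (n : ℕ) :
    ∀ᵐ v : Fin n → Plane ∂volume,
      AlgebraicIndependent ℚ (fun ij : Fin n × Fin 2 => v ij.1 ij.2) := by
  set L := (coordEquiv n).toContinuousLinearEquiv with hL
  -- A linear isomorphism carries Lebesgue measure to a Haar measure, so null sets can be pulled
  -- back.
  have hHaar : (Measure.map L (volume : Measure (Fin n → Plane))).IsAddHaarMeasure :=
    L.isAddHaarMeasure_map _
  have hac : Measure.map L (volume : Measure (Fin n → Plane)) ≪ volume :=
    Measure.absolutelyContinuous_isAddHaarMeasure _ _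
  have h1 := hac.ae_le (ae_algebraicIndependent (n * 2))
  have h2 := ae_of_ae_map L.continuous.measurable.aemeasurable h1
  filter_upwards [h2] with v hv
  exact (algebraicIndependent_equiv' finProdFinEquiv.symm rfl).1 hv

/-! ### Convex position and the main theorem -/

/-- The vertices of a proper sequence are in convex position. -/
theorem convexIndependent_of_slack_pos {n : ℕ} (hn : 3 ≤ n) {v : Fin n → Plane}
    (h : ∀ i j, i ≠ j → i ≠ finRotate n j → 0 < slack v i j) : ConvexIndependent ℝ v := by
  rw [convexIndependent_iff_notMem_convexHull_sdiff]
  intro i s hi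
  obtain ⟨j, hj⟩ := (finRotate n).surjective i
  have hji : j ≠ i := fun h' => finRotate_ne_self (by omega) j (by rw [hj, h'])
  -- The sum of the functionals of the two edges at `v i` has its strict maximum over the vertices
  -- there.
  set f : Plane →L[ℝ] ℝ := edgeFunctional (v i) (v (finRotate n i)) +
    edgeFunctional (v j) (v i) with hf
  have hfi : ∀ x, f x = f (v i) - (orientedArea x (v i) (v (finRotate n i)) +
      orientedArea x (v j) (v i)) := by
    intro x
    simp only [hf, add_apply, edgeFunctional_apply, orientedArea]
    ring
  have hsub : convexHull ℝ (v '' (s \ {i})) ⊆ {x | f x < f (v i)} := by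
    refine convexHull_min ?_ (convex_halfSpace_lt f.toLinearMap.isLinear _)
    rintro _ ⟨k, ⟨-, hk⟩, rfl⟩
    have hk : k ≠ i := hk
    change f (v k) < f (v i)
    rw [hfi (v k)]
    have h1 := slack_nonneg h k i
    have h2 := slack_nonneg h k j
    have h3 : 0 < slack v k i + slack v k j := by
      rcases eq_or_ne k j with hkj | hkj
      · refine add_pos_of_pos_of_nonneg (h k i hk ?_) h2
        rintro rfl
        rw [← hkj] at hj
        exact finRotate_finRotate_ne_self hn i hj
      · exact add_pos_of_nonneg_of_pos h1 (h k j hkj (by rwa [hj]))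
    simp only [slack, hj] at h3
    linarith
  exact lt_irrefl (f (v i)) (hsub hi)

theorem IsAdmissible.extensionComplexity_le {n : ℕ} (hn : 3 ≤ n) {v : Fin n → Plane}
    (hv : IsAdmissible v) :
    extensionComplexity (convexHull ℝ (Set.range v)) ≤ (⌊17 * √(n : ℝ)⌋₊ : ℕ∞) :=
  extensionComplexity_le_of_nonnegRankLE hn hv.1.slack_pos hv.nonnegRankLE_slack

theorem ae_isAdmissible_imp_isGenericPolygon {n : ℕ} (hn : 3 ≤ n) :
    ∀ᵐ v : Fin n → Plane ∂volume, IsAdmissible v → IsGenericPolygon v := by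
  filter_upwards [ae_algebraicIndependent_coords n] with v hv hadm
  exact ⟨convexIndependent_of_slack_pos hn hadm.1.slack_pos, hv⟩

theorem exists_isAdmissible_isGenericPolygon {n : ℕ} (hn : 3 ≤ n) :
    ∃ v : Fin n → Plane, IsAdmissible v ∧ IsGenericPolygon v := by
  have h1 : volume {v : Fin n → Plane | IsAdmissible v} ≠ 0 :=
    ((isOpen_setOf_isAdmissible hn).measure_pos volume (exists_isAdmissible hn)).ne'
  obtain ⟨v, hv, hv'⟩ := ((frequently_ae_iff.2 h1).and_eventually
    (ae_isAdmissible_imp_isGenericPolygon hn)).exists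
  exact ⟨v, hv, hv' hv⟩

theorem mainTheorem6 :
    (∀ n : ℕ, 3 ≤ n →
      IsOpen {v : Fin n → Plane | IsAdmissible v} ∧
      {v : Fin n → Plane | IsAdmissible v}.Nonempty ∧
      (∀ v : Fin n → Plane, IsAdmissible v →
        extensionComplexity (convexHull ℝ (Set.range v)) ≤ (⌊17 * √(n : ℝ)⌋₊ : ℕ∞)) ∧
      (∀ᵐ v : Fin n → Plane ∂volume, IsAdmissible v → IsGenericPolygon v) ∧
      (∃ v : Fin n → Plane, IsAdmissible v ∧ IsGenericPolygon v ∧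
        extensionComplexity (convexHull ℝ (Set.range v)) ≤ (⌊17 * √(n : ℝ)⌋₊ : ℕ∞))) ∧
    (∀ f : ℕ → ℝ,
      (∀ᶠ n : ℕ in atTop, ∀ v : Fin n → Plane, IsGenericPolygon v →
        ∀ k : ℕ, extensionComplexity (convexHull ℝ (Set.range v)) = (k : ℕ∞) → f n ≤ (k : ℝ)) →
      ∀ᶠ n : ℕ in atTop, f n ≤ 17 * √(n : ℝ)) := by
  refine ⟨fun n hn => ⟨isOpen_setOf_isAdmissible hn, exists_isAdmissible hn,
    fun v hv => hv.extensionComplexity_le hn, ae_isAdmissible_imp_isGenericPolygon hn, ?_⟩,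
    fun f hf => ?_⟩
  · obtain ⟨v, hv, hv'⟩ := exists_isAdmissible_isGenericPolygon hn
    exact ⟨v, hv, hv', hv.extensionComplexity_le hn⟩
  · filter_upwards [hf, eventually_ge_atTop 3] with n hfn hn
    obtain ⟨v, hv, hv'⟩ := exists_isAdmissible_isGenericPolygon hn
    have hle := hv.extensionComplexity_le hn
    -- The upper bound makes the extension complexity a natural number, as the hypothesis on `f`
    -- requires.
    obtain ⟨k, hk⟩ := ENat.ne_top_iff_exists.1 (ne_top_of_le_ne_top (ENat.natCast_ne_top _) hle)
    rw [← hk, Nat.cast_le] at hle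
    refine (hfn v hv' k hk.symm).trans (le_trans (Nat.cast_le.2 hle) (Nat.floor_le (by positivity)))
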